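/- All logarithms are to base $2$. Let $\mathcal X,\mathcal Y$ be finite sets. For every $n$ let $(\mathcal A_n,p_{A,n})$ and $(\mathcal B_n,p_{B,n})$ be finite sets of (possibly non-linear) functions $A:\mathcal X^n\to\overline{\mathcal U}_{A,n}$ and $B:\mathcal X^n\to\overline{\mathcal U}_{B,n}$ into finite sets, with probability distributions on them; let $\operatorname{Im}\mathcal A=\bigcup_{A\in\mathcal A}\operatorname{Im}A$, and identify $(A,B)\in\mathcal A\times\mathcal B$ with the function $\boldsymbol u\mapsto(A\boldsymbol u,B\boldsymbol u)$. A sequence of ensembles $(\mathcal A,p)$ of functions $\mathcal X^n\to\overline{\mathcal U}$ has the $(\boldsymbol\alpha,\boldsymbol\beta)$-hash property if $\operatorname{Im}A=\operatorname{Im}\mathcal A$ for all $A\in\mathcal A$, $\frac1n\log\frac{|\overline{\mathcal U}|}{|\operatorname{Im}\mathcal A|}\to0$, $\alpha(n)\to1$, $\beta(n)\to0$, and for all $n\ge1$ and $\mathcal T,\mathcal T'\subset\mathcal X^n$ $$\sum_{\boldsymbol u\in\mathcal T,\ \boldsymbol u'\in\mathcal T'}p(\{A:A\boldsymbol u=A\boldsymbol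 u'\})\le|\mathcal T\cap\mathcal T'|+\frac{|\mathcal T||\mathcal T'|\alpha(n)}{|\operatorname{Im}\mathcal A|}+\min\{|\mathcal T|,|\mathcal T'|\}\beta(n).$$ Assume that $(\mathcal A,p_A)$ has the $(\boldsymbol\alpha_A,\boldsymbol\beta_A)$-hash property, that $(\mathcal A\times\mathcal B,p_A\times p_B)$ has the $(\boldsymbol\alpha_{AB},\boldsymbol\beta_{AB})$-hash property, and that $\operatorname{Im}(\mathcal A\times\mathcal B)=\operatorname{Im}\mathcal A\times\operatorname{Im}\mathcal B$ for $n\ge1$. Let $R_A,R_B>0$ with $\frac1n\log|\operatorname{Im}\mathcal A_n|\to R_A$ and $\frac1n\log|\operatorname{Im}\mathcal B_n|\to R_B$. Let $\mu_X$ be a probability distribution on $\mathcal X$ with $H(X)>R_A+R_B$, and let $\kappa(n)$ be any sequence with $\kappa(n)\to\infty$, $\kappa(n)\beta_A(n)\to0$ and $\frac{\log\kappa(n)}n\to0$. Let $\nu$ denote empirical distributions (types) and conditional types, let $H(\boldsymbol x|\boldsymbol y)$ be the empirical conditional entropy, and let $|\theta|^+=\max\{\theta,0\}$. Given $A$, $B$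 and $\boldsymbol c\in\operatorname{Im}A$, a message $\boldsymbol m\in\operatorname{Im}B$ is encoded by the minimum-divergence encoder as $g_{AB}(\boldsymbol c,\boldsymbol m)=\arg\min\{D(\nu_{\boldsymbol x'}\|\mu_X):A\boldsymbol x'=\boldsymbol c,\ B\boldsymbol x'=\boldsymbol m\}$, where ties are resolved by an arbitrary enumeration of $\mathcal X^n$ fixed in advance (if there is no such $\boldsymbol x'$, the message counts as an error). The output $\boldsymbol y\in\mathcal Y^n$ is decoded as $B\,g_A(\boldsymbol c,\boldsymbol y)$, where $g_A(\boldsymbol c,\boldsymbol y)$ is any minimizer of $H(\boldsymbol x'|\boldsymbol y)$ over $\{\boldsymbol x':A\boldsymbol x'=\boldsymbol c\}$ (minimum-entropy decoder). $\mathrm{Error}_{Y|X}(A,B,\boldsymbol c)$ is the error probability for $\boldsymbol m$ uniform on $\operatorname{Im}B$ and the stationary memoryless channel $\mu_{Y|X}$. Let $U=U_n$ be a type of sequences of length $n$ minimizing $D(\nu_U\|\mu_X)$, and put $$F_{Y|X}(R)=\min_{V|U}\bigl[D(\nu_{V|U}\|\mu_{Y|X}|\nu_U)+|R-H(U|V)|^+\bigr],\qquad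 \lambda_{\mathcal X\mathcal Y}=\frac{|\mathcal X||\mathcal Y|\log(n+1)}n,$$ the minimum being over the conditional types $V|U$ of sequences of length $n$ given type $U$. For $\delta\ge0$ let $\mathcal W_\delta$ be the set of all channels $\mu_{Y|X}:\mathcal X\to\mathcal Y$ with $H(X|Y)<R_A-\delta$, and $$\mathrm{Bound}_\delta(n)=\alpha_{AB}-1+\frac{\beta_{AB}+1}\kappa+2\kappa\Bigl[\max\{\alpha_A,1\}\,2^{-n[\inf_{\mathcal W_\delta}F_{Y|X}(R_A)-2\lambda_{\mathcal X\mathcal Y}]}+\beta_A\Bigr].$$ Then there are $A_n\in\mathcal A_n$, $B_n\in\mathcal B_n$ and $\boldsymbol c_n\in\operatorname{Im}A_n$, for all $n$, not depending on the channel, such that: (i) for every $\delta\ge0$ and all sufficiently large $n$, $\mathrm{Error}_{Y|X}(A_n,B_n,\boldsymbol c_n)\le\mathrm{Bound}_\delta(n)$ for all $\mu_{Y|X}\in\mathcal W_\delta$ simultaneously (in particular, for $\delta=0$, for all channels with $H(X|Y)<R_A$); (ii) $\mathrm{Error}_{Y|X}(A_n,B_n,\boldsymbol c_n)\to0$ for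 every channel $\mu_{Y|X}$ with $H(X|Y)<R_A$. Moreover, (iii) for every $\delta>0$ there is $\varepsilon>0$ with $\inf_{\mathcal W_\delta}F_{Y|X}(R_A)\ge\varepsilon$ for all sufficiently large $n$, and $\mathrm{Bound}_\delta(n)\to0$ whenever $\mathcal W_\delta\neq\emptyset$. -/

import Mathlib

open Filter Topology

noncomputable section

namespace UnivChannel

universe u v w

/-! ### Probability distributions, entropies and divergences (logarithms to base two) -/

/-- `p` is a probability distribution on the finite set `U`. -/
def IsPMF {U : Type*} [Fintype U] (p : U → ℝ) : Prop :=
  (∀ a, 0 ≤ p a) ∧ ∑ a, p a = 1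

/-- `q` is a conditional distribution: `q b a` is the probability of `a` given `b`. -/
def IsChannel {V U : Type*} [Fintype U] (q : V → U → ℝ) : Prop :=
  ∀ b, IsPMF (q b)

/-- The entropy `H(p)`. -/
def entropy {U : Type*} [Fintype U] (p : U → ℝ) : ℝ :=
  ∑ a, p a * Real.logb 2 (1 / p a)

/-- The conditional entropy `H(q | p)`, where `q b a` stands for `q(a | b)`. -/
def condEntropy {U V : Type*} [Fintype U] [Fintype V] (q : V → U → ℝ) (p : V → ℝ) : ℝ :=
  ∑ b, ∑ a, q b a * p b * Real.logb 2 (1 / q b a)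

open Classical in
/-- The divergence `D(p ‖ p')`, equal to `⊤` unless `p` is absolutely continuous
with respect to `p'`. -/
def divergence {U : Type*} [Fintype U] (p p' : U → ℝ) : EReal :=
  if ∀ a, p' a = 0 → p a = 0 then
    ((∑ a, p a * Real.logb 2 (p a / p' a) : ℝ) : EReal)
  else ⊤

open Classical in
/-- The conditional divergence `D(q ‖ q' | p)`. -/
def condDivergence {U V : Type*} [Fintype U] [Fintype V]
    (q q' : V → U → ℝ) (p : V → ℝ) : EReal :=
  if ∀ b a, p b ≠ 0 → q' b a = 0 → q b a = 0 then
    ((∑ b, p b * ∑ a, q b a * Real.logb 2 (q b a / q' b a) : ℝ) : EReal)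
  else ⊤

/-- The output distribution `μ_Y` of the channel `W` under the input distribution `μX`. -/
def outputDist {X Y : Type*} [Fintype X] (μX : X → ℝ) (W : X → Y → ℝ) (y : Y) : ℝ :=
  ∑ x, μX x * W x y

/-- The backward conditional distribution `μ_{X|Y}`. -/
def posterior {X Y : Type*} [Fintype X] (μX : X → ℝ) (W : X → Y → ℝ) (y : Y) (x : X) : ℝ :=
  μX x * W x y / outputDist μX W y

/-- `H(X | Y)` for the input distribution `μX` and the channel `W`. -/
def equivocation {X Y : Type*} [Fintype X] [Fintype Y] (μX : X → ℝ) (W : X → Y → ℝ) : ℝ :=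
  condEntropy (posterior μX W) (outputDist μX W)

/-! ### Types of sequences -/

open Classical in
/-- The type (empirical distribution) of a sequence. -/
def seqType {U : Type*} {n : ℕ} (x : Fin n → U) (a : U) : ℝ :=
  ((Finset.univ.filter fun i => x i = a).card : ℝ) / n

/-- The conditional type of `x` given `y`: `condType x y b a` is `ν_{x|y}(a | b)`. -/
def condType {U V : Type*} {n : ℕ} (x : Fin n → U) (y : Fin n → V) (b : V) (a : U) : ℝ :=
  seqType (fun i => (x i, y i)) (a, b) / seqType y b

/-- The empirical conditional entropy `H(x | y)`. -/
def empCondEntropy {U V : Type*} [Fintype U] [Fintype V] {n : ℕ}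
    (x : Fin n → U) (y : Fin n → V) : ℝ :=
  condEntropy (condType x y) (seqType y)

/-- `U` is, among all types of sequences of length `n`, one closest to `μX` in divergence. -/
def IsNearestType {X : Type*} [Fintype X] (μX : X → ℝ) (n : ℕ) (U : X → ℝ) : Prop :=
  (∃ x : Fin n → X, seqType x = U) ∧
    ∀ x : Fin n → X, divergence U μX ≤ divergence (seqType x) μX

/-- `λ_{XY}(n) = |X||Y| log (n+1) / n`. -/
def lam (X Y : Type*) [Fintype X] [Fintype Y] (n : ℕ) : ℝ :=
  (Fintype.card X * Fintype.card Y : ℝ) * Real.logb 2 (n + 1) / n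

/-! ### Ensembles of functions and the hash property -/

/-- A finite set of functions with a probability distribution on it. -/
structure Ensemble (D : Type*) (C : Type*) where
  fns : Finset (D → C)
  prob : (D → C) → ℝ
  prob_nonneg : ∀ A ∈ fns, 0 ≤ prob A
  sum_prob : ∑ A ∈ fns, prob A = 1

/-- The union of the images of the members of the ensemble. -/
def Ensemble.im {D C : Type*} (E : Ensemble D C) : Set C :=
  {c | ∃ A ∈ E.fns, ∃ x, A x = c}

open Classical in
/-- The probability that `x` and `x'` have the same value. -/
def Ensemble.collision {D C : Type*} (E : Ensemble D C) (x x' : D) : ℝ :=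
  ∑ A ∈ E.fns.filter (fun A => A x = A x'), E.prob A

/-- A pair of functions, as the function `x ↦ (A x, B x)`. -/
def pairEmb (D C C' : Type*) : (D → C) × (D → C') ↪ (D → C × C') where
  toFun f := fun x => (f.1 x, f.2 x)
  inj' f g h := by
    apply Prod.ext
    · funext x
      exact congrArg Prod.fst (congrFun h x)
    · funext x
      exact congrArg Prod.snd (congrFun h x)

/-- The ensemble of the functions `x ↦ (A x, B x)` with `A`, `B` drawn independently. -/
def Ensemble.prod {D C C' : Type*} (E : Ensemble D C) (E' : Ensemble D C') :
    Ensemble D (C × C') where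
  fns := (E.fns ×ˢ E'.fns).map (pairEmb D C C')
  prob f := E.prob (fun x => (f x).1) * E'.prob (fun x => (f x).2)
  prob_nonneg := by
    intro f hf
    obtain ⟨⟨A, B⟩, hAB, rfl⟩ := Finset.mem_map.1 hf
    obtain ⟨hA, hB⟩ := Finset.mem_product.1 hAB
    exact mul_nonneg (E.prob_nonneg A hA) (E'.prob_nonneg B hB)
  sum_prob := by
    rw [Finset.sum_map, Finset.sum_product]
    change ∑ A ∈ E.fns, ∑ B ∈ E'.fns, E.prob A * E'.prob B = 1
    rw [← Finset.sum_mul_sum, E.sum_prob, E'.sum_prob, one_mul]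

open Classical in
/-- The `(α, β)`-hash property of a sequence of ensembles of functions on `X^n`. -/
structure HashProperty {X : Type u} [Fintype X] {C : ℕ → Type v} [∀ n, Fintype (C n)]
    (E : ∀ n, Ensemble (Fin n → X) (C n)) (α β : ℕ → ℝ) : Prop where
  range_eq : ∀ n, 1 ≤ n → ∀ A ∈ (E n).fns, Set.range A = (E n).im
  im_rate : Tendsto
    (fun n : ℕ => Real.logb 2 ((Fintype.card (C n) : ℝ) / ((E n).im.ncard : ℝ)) / n)
    atTop (𝓝 0)
  alpha_lim : Tendsto α atTop (𝓝 1)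
  beta_lim : Tendsto β atTop (𝓝 0)
  collision_le : ∀ n, 1 ≤ n → ∀ T T' : Finset (Fin n → X),
    ∑ x ∈ T, ∑ x' ∈ T', (E n).collision x x' ≤
      ((T ∩ T').card : ℝ) + (T.card : ℝ) * (T'.card : ℝ) * α n / ((E n).im.ncard : ℝ)
        + min (T.card : ℝ) (T'.card : ℝ) * β n

/-! ### The code -/

/-- `x` is the minimum-divergence codeword for `(c, m)`: it lies in `C_{AB}(c, m)`, minimizes the
divergence of its type from `μX` there, and is the first such sequence in the enumeration `r`. -/
def IsMinDivWord {X C C' : Type*} [Fintype X] {n : ℕ} (μX : X → ℝ) (r : (Fin n → X) → ℕ)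
    (A : (Fin n → X) → C) (B : (Fin n → X) → C') (c : C) (m : C') (x : Fin n → X) : Prop :=
  (A x = c ∧ B x = m) ∧
    ∀ x', A x' = c → B x' = m →
      divergence (seqType x) μX < divergence (seqType x') μX ∨
        (divergence (seqType x) μX = divergence (seqType x') μX ∧ r x ≤ r x')

open Classical in
/-- The minimum-divergence encoder `g_{AB}(c, ·)`; it has no value at `m` if `C_{AB}(c, m)` is
empty. -/
def minDivEncoder {X C C' : Type*} [Fintype X] {n : ℕ} (μX : X → ℝ) (r : (Fin n → X) → ℕ)
    (A : (Fin n → X) → C) (B : (Fin n → X) → C') (c : C) (m : C') : Option (Fin n → X) :=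
  if h : ∃ x, IsMinDivWord μX r A B c m x then some h.choose else none

/-- `g` is a minimum-entropy decoder `g_A(c, ·)`: `g y` minimizes `H(x' | y)` over `C_A(c)`. -/
def IsMinEntropyDecoder {X Y C : Type*} [Fintype X] [Fintype Y] {n : ℕ}
    (A : (Fin n → X) → C) (c : C) (g : (Fin n → Y) → (Fin n → X)) : Prop :=
  ∀ y, A (g y) = c ∧ ∀ x', A x' = c → empCondEntropy (g y) y ≤ empCondEntropy x' y

open Classical in
/-- The conditional error probability of the message `m`, sent as the codeword `φ m` over the
memoryless channel `W` and decoded as `B (g y)`. A message without a codeword is an error. -/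
def messageError {X Y C' : Type*} [Fintype Y] {n : ℕ} (W : X → Y → ℝ)
    (B : (Fin n → X) → C') (φ : C' → Option (Fin n → X)) (g : (Fin n → Y) → (Fin n → X))
    (m : C') : ℝ :=
  match φ m with
  | none => 1
  | some x => ∑ y : Fin n → Y, (∏ i, W (x i) (y i)) * (if B (g y) = m then 0 else 1)

open Classical in
/-- The error probability for a message uniformly distributed on `Im B`. -/
def codeError {X Y C' : Type*} [Fintype X] [Fintype Y] {n : ℕ} (W : X → Y → ℝ)
    (B : (Fin n → X) → C') (φ : C' → Option (Fin n → X)) (g : (Fin n → Y) → (Fin n → X)) : ℝ :=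
  ∑ m ∈ Finset.univ.image B, 1 / ((Set.range B).ncard : ℝ) * messageError W B φ g m

/-! ### The error exponent and the error bound -/

/-- `F_{Y|X}(R)` at length `n`: the minimum, over the conditional types `V|U` of sequences of
length `n` given the type `U`, of `D(V|U ‖ W | U) + |R - H(U|V)|⁺`. -/
def exponent {X Y : Type*} [Fintype X] [Fintype Y] (n : ℕ) (U : X → ℝ) (R : ℝ)
    (W : X → Y → ℝ) : EReal :=
  ⨅ (x : Fin n → X) (y : Fin n → Y) (_ : seqType x = U),
    condDivergence (condType y x) W U + ((max (R - empCondEntropy x y) 0 : ℝ) : EReal)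

/-- The channels with `H(X | Y) < R`. -/
def channelClass {X : Type*} (Y : Type*) [Fintype X] [Fintype Y] (μX : X → ℝ) (R : ℝ) :
    Set (X → Y → ℝ) :=
  {W | IsChannel W ∧ equivocation μX W < R}

/-- The infimum of `F_{Y|X}(R)` over the channels with `H(X | Y) < R - δ`. -/
def infExponent {X : Type*} (Y : Type*) [Fintype X] [Fintype Y] (μX : X → ℝ) (n : ℕ)
    (U : X → ℝ) (R δ : ℝ) : EReal :=
  ⨅ W ∈ channelClass Y μX (R - δ), exponent n U R W

/-- The bound on the error probability, with exponent `F`. -/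
def errorBound (X Y : Type*) [Fintype X] [Fintype Y] (n : ℕ)
    (αA βA αAB βAB κ F : ℝ) : ℝ :=
  αAB - 1 + (βAB + 1) / κ +
    2 * κ * (max αA 1 * (2 : ℝ) ^ (-(n : ℝ) * (F - 2 * lam X Y n)) + βA)

end UnivChannel

end

/-!
The proof is a random coding argument by types, arranged so that nothing that is averaged depends
on the channel.

*Code words.* The encoder prefers sequences in the order of `encoderKey`: divergence of the type
first, enumeration second. Let `T` be the initial segment of this order with about
`5/4 * κ |Im A| |Im B|` elements. Since `RA + RB < H(X)` and `κ` is subexponential, `T` is smaller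
than the set of sequences of type within any fixed divergence of `μX`
(`eventually_le_card_divergence_le`), so the types in `T` tend to `μX`; ties between nearest types
therefore do no harm. If a fibre of `(A, B)` meets `T`, its code word lies in `T`, and by
Chebyshev's inequality and the hash property of the pair few fibres miss `T`
(`Ensemble.sum_card_empty_fiber_le`).

*Decoding errors.* If `x` is sent and `y` is decoded wrongly, there is `x' ≠ x` with
`A x' = A x` and `H(x'|y) ≤ H(x|y)`. The hash property bounds the sum of the collision
probabilities of all `x'` that collide with `x` more often than `4 max(α, 0) / |Im A|`, the
`heavy` ones, by `4/3 max(β, 0)`, for all `y` and all channels at once. The other `x'` are treated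
by a union bound over the `2^{n H(x|y)}` (up to a polynomial) sequences in question, with each `y`
given the weight `outputWeight`. This weight does not depend on the channel, but times `2^{-nε}`
it dominates the transition probabilities of every channel whose exponents are at least `ε`
(`prod_le_outputWeight`). One choice of `A`, `B`, `c` thus serves all channels (`exists_code`,
`exists_universal_codes`).

*Exponents.* If `H(X|Y) < RA - δ`, then a joint type of small conditional divergence from the
channel and input type close to `μX` has an empirical conditional entropy below `RA - δ/2`, so the
exponent is bounded away from zero, uniformly (`exists_exponent_lower_bound`). For `δ > 0` the
exponentially small term fits into the margin of order `1/κ` left by the size of `T`.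

*The case `δ = 0`.* Here the exponents of the class have no positive lower bound, and the error
bound is trivial: along a segment of channels that reaches equivocation `RA`, rounding to types of
length `n` costs `O(1/n)`, which is less than the polynomial loss `2 λ`
(`eventually_infExponent_zero_le`), so that the bound is at least `1`.
-/

noncomputable section

namespace UnivChannel

/-! ### Empirical distributions and the method of types -/

section Types

variable {X Y : Type*} {n : ℕ}

lemma seqType_nonneg {U : Type*} (x : Fin n → U) (a : U) : 0 ≤ seqType x a := by
  unfold seqType; positivity

lemma seqType_pos {U : Type*} (x : Fin n → U) (i : Fin n) : 0 < seqType x (x i) := by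
  classical
  have hn : 0 < n := i.pos
  unfold seqType
  have : 0 < (Finset.univ.filter fun j => x j = x i).card :=
    Finset.card_pos.2 ⟨i, by simp⟩
  positivity

lemma seqType_swap (x : Fin n → X) (y : Fin n → Y) (a : X) (b : Y) :
    seqType (fun i => (y i, x i)) (b, a) = seqType (fun i => (x i, y i)) (a, b) := by
  classical
  unfold seqType
  congr 3
  ext i
  simp [and_comm]

lemma condType_nonneg (x : Fin n → X) (y : Fin n → Y) (b : Y) (a : X) :
    0 ≤ condType x y b a :=
  div_nonneg (seqType_nonneg _ _) (seqType_nonneg _ _)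

lemma condType_pos (x : Fin n → X) (y : Fin n → Y) (i : Fin n) :
    0 < condType x y (y i) (x i) :=
  div_pos (seqType_pos (fun i => (x i, y i)) i) (seqType_pos y i)

lemma exists_of_seqType_ne_zero {U : Type*} {x : Fin n → U} {a : U} (h : seqType x a ≠ 0) :
    ∃ i, x i = a := by
  classical
  by_contra! hc
  apply h
  unfold seqType
  rw [Finset.filter_false_of_mem (fun i _ => hc i)]
  simp

lemma sum_seqType_mul {U : Type*} [Fintype U] (x : Fin n → U) (f : U → ℝ) :
    (n : ℝ) * ∑ a, seqType x a * f a = ∑ i, f (x i) := by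
  classical
  rcases Nat.eq_zero_or_pos n with rfl | hn
  · simp
  · have hn' : (n : ℝ) ≠ 0 := by positivity
    rw [← Finset.sum_fiberwise Finset.univ x (fun i => f (x i)), Finset.mul_sum]
    refine Finset.sum_congr rfl fun a _ => ?_
    rw [Finset.sum_congr rfl (g := fun _ => f a)
      (fun i hi => by rw [(Finset.mem_filter.1 hi).2]), Finset.sum_const, nsmul_eq_mul]
    unfold seqType
    field_simp

lemma sum_seqType {U : Type*} [Fintype U] (hn : n ≠ 0) (x : Fin n → U) :
    ∑ a, seqType x a = 1 := by
  have h := sum_seqType_mul x (fun _ => 1)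
  simp only [mul_one, Finset.sum_const, Finset.card_univ, Fintype.card_fin, nsmul_eq_mul] at h
  have hn' : (n : ℝ) ≠ 0 := by exact_mod_cast hn
  exact mul_left_cancel₀ hn' (by rw [h, mul_one])

lemma isPMF_seqType {U : Type*} [Fintype U] (hn : n ≠ 0) (x : Fin n → U) :
    IsPMF (seqType x) :=
  ⟨seqType_nonneg x, sum_seqType hn x⟩

variable [Fintype X] [Fintype Y]

lemma sum_seqType_pair (x : Fin n → X) (y : Fin n → Y) (b : Y) :
    ∑ a, seqType (fun i => (x i, y i)) (a, b) = seqType y b := by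
  classical
  rcases Nat.eq_zero_or_pos n with rfl | hn
  · simp [seqType]
  have hn' : (n : ℝ) ≠ 0 := by positivity
  apply mul_left_cancel₀ hn'
  have h1 := sum_seqType_mul (fun i => (x i, y i)) (fun p => if p.2 = b then 1 else 0)
  have h2 := sum_seqType_mul y (fun p => if p = b then 1 else 0)
  rw [Fintype.sum_prod_type] at h1
  simp only [mul_ite, mul_one, mul_zero, Finset.sum_ite_eq', Finset.mem_univ, if_true] at h1 h2
  rw [h1, h2]

lemma condType_mul_seqType (x : Fin n → X) (y : Fin n → Y) (b : Y) (a : X) :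
    condType x y b a * seqType y b = seqType (fun i => (x i, y i)) (a, b) := by
  unfold condType
  by_cases h : seqType y b = 0
  · rw [h, mul_zero]
    have := sum_seqType_pair x y b
    rw [h] at this
    exact ((Finset.sum_eq_zero_iff_of_nonneg fun a _ => seqType_nonneg _ _).1 this a
      (Finset.mem_univ a)).symm
  · exact div_mul_cancel₀ _ h

lemma sum_condType (x : Fin n → X) (y : Fin n → Y) {b : Y} (hb : seqType y b ≠ 0) :
    ∑ a, condType x y b a = 1 := by
  unfold condType
  rw [← Finset.sum_div, sum_seqType_pair, div_self hb]

lemma sum_condType_le (x : Fin n → X) (y : Fin n → Y) (b : Y) :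
    ∑ a, condType x y b a ≤ 1 := by
  by_cases hb : seqType y b = 0
  · simp [condType, hb]
  · exact (sum_condType x y hb).le

/-- Averages over the positions of a pair of sequences are averages over the joint type. -/
lemma sum_condType_mul (x : Fin n → X) (y : Fin n → Y) (f : Y → X → ℝ) :
    (n : ℝ) * ∑ b, ∑ a, condType x y b a * seqType y b * f b a = ∑ i, f (y i) (x i) := by
  rw [← sum_seqType_mul (fun i => (x i, y i)) (fun p => f p.2 p.1), Fintype.sum_prod_type,
    Finset.sum_comm]
  simp only [condType_mul_seqType]

lemma prod_eq_two_rpow {f : Fin n → ℝ} (hf : ∀ i, 0 < f i) :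
    ∏ i, f i = (2 : ℝ) ^ (∑ i, Real.logb 2 (f i)) := by
  rw [Real.rpow_sum_of_pos (by norm_num : (0 : ℝ) < 2)]
  exact Finset.prod_congr rfl fun i _ =>
    (Real.rpow_logb (by norm_num) (by norm_num) (hf i)).symm

lemma prod_condType (x : Fin n → X) (y : Fin n → Y) :
    ∏ i, condType x y (y i) (x i) = (2 : ℝ) ^ (-(n : ℝ) * empCondEntropy x y) := by
  rw [prod_eq_two_rpow fun i => condType_pos x y i]
  congr 1
  rw [← sum_condType_mul x y (fun b a => Real.logb 2 (condType x y b a)), neg_mul,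
    empCondEntropy, condEntropy, ← mul_neg, ← Finset.sum_neg_distrib]
  congr 1
  refine Finset.sum_congr rfl fun b _ => ?_
  rw [← Finset.sum_neg_distrib]
  refine Finset.sum_congr rfl fun a _ => ?_
  rw [one_div, Real.logb_inv]
  ring

/-- The number of joint types is polynomial in the length, and the sequences of a given
conditional type have total weight at most one under the product of that type. -/
lemma sum_two_rpow_neg_empCondEntropy_le (y : Fin n → Y) :
    ∑ x : Fin n → X, (2 : ℝ) ^ (-(n : ℝ) * empCondEntropy x y) ≤
      ((n : ℝ) + 1) ^ (Fintype.card X * Fintype.card Y) := by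
  classical
  -- `counts x` determines the conditional type of `x` given `y`
  let counts : (Fin n → X) → (X × Y → Fin (n + 1)) := fun x p =>
    ⟨(Finset.univ.filter fun i => (x i, y i) = p).card, by
      have := Finset.card_filter_le (Finset.univ : Finset (Fin n)) (fun i => (x i, y i) = p)
      simp only [Finset.card_univ, Fintype.card_fin] at this
      omega⟩
  let V : (X × Y → Fin (n + 1)) → Y → X → ℝ := fun k b a =>
    ((k (a, b) : ℕ) : ℝ) / n / seqType y b
  have hV : ∀ x, condType x y = V (counts x) := by
    intro x
    funext b a
    simp only [condType, V, counts, seqType]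
  have hle : ∀ k ∈ Finset.univ.image counts,
      ∑ x : Fin n → X, ∏ i, V k (y i) (x i) ≤ 1 := by
    intro k hk
    obtain ⟨x, -, rfl⟩ := Finset.mem_image.1 hk
    rw [← hV, ← Fintype.prod_sum (fun i a => condType x y (y i) a)]
    exact Finset.prod_le_one (fun i _ => Finset.sum_nonneg fun a _ => condType_nonneg _ _ _ _)
      (fun i _ => sum_condType_le _ _ _)
  have hV0 : ∀ k b a, 0 ≤ V k b a := fun k b a =>
    div_nonneg (by positivity) (seqType_nonneg _ _)
  calc ∑ x : Fin n → X, (2 : ℝ) ^ (-(n : ℝ) * empCondEntropy x y)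
      = ∑ x : Fin n → X, ∏ i, V (counts x) (y i) (x i) := by
        refine Finset.sum_congr rfl fun x _ => ?_
        rw [← prod_condType, hV]
    _ ≤ ∑ x : Fin n → X, ∑ k ∈ Finset.univ.image counts, ∏ i, V k (y i) (x i) := by
        refine Finset.sum_le_sum fun x _ => ?_
        exact Finset.single_le_sum (f := fun k => ∏ i, V k (y i) (x i))
          (fun k _ => Finset.prod_nonneg fun i _ => hV0 _ _ _)
          (Finset.mem_image_of_mem _ (Finset.mem_univ x))
    _ = ∑ k ∈ Finset.univ.image counts, ∑ x : Fin n → X, ∏ i, V k (y i) (x i) :=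
        Finset.sum_comm
    _ ≤ ∑ k ∈ Finset.univ.image counts, 1 := Finset.sum_le_sum hle
    _ ≤ ((n : ℝ) + 1) ^ (Fintype.card X * Fintype.card Y) := by
        rw [Finset.sum_const, nsmul_eq_mul, mul_one]
        have h := Finset.card_le_univ (Finset.univ.image counts)
        rw [Fintype.card_fun, Fintype.card_prod, Fintype.card_fin] at h
        exact_mod_cast h

open Classical in
lemma card_empCondEntropy_le (y : Fin n → Y) (h : ℝ) :
    ((Finset.univ.filter fun x : Fin n → X => empCondEntropy x y ≤ h).card : ℝ) ≤
      ((n : ℝ) + 1) ^ (Fintype.card X * Fintype.card Y) * (2 : ℝ) ^ ((n : ℝ) * h) := by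
  have h1 : ((Finset.univ.filter fun x : Fin n → X => empCondEntropy x y ≤ h).card : ℝ) *
      (2 : ℝ) ^ (-(n : ℝ) * h) ≤ ((n : ℝ) + 1) ^ (Fintype.card X * Fintype.card Y) := by
    refine le_trans ?_ (sum_two_rpow_neg_empCondEntropy_le (X := X) y)
    rw [← nsmul_eq_mul, ← Finset.sum_const]
    refine le_trans (Finset.sum_le_sum fun x hx => ?_)
      (Finset.sum_le_sum_of_subset_of_nonneg (Finset.subset_univ _)
        fun x _ _ => by positivity)
    apply Real.rpow_le_rpow_of_exponent_le (by norm_num)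
    have := (Finset.mem_filter.1 hx).2
    have : (n : ℝ) * empCondEntropy x y ≤ n * h := by gcongr
    linarith
  calc _ = ((Finset.univ.filter fun x : Fin n → X => empCondEntropy x y ≤ h).card : ℝ) *
        (2 : ℝ) ^ (-(n : ℝ) * h) * (2 : ℝ) ^ ((n : ℝ) * h) := by
        rw [mul_assoc, ← Real.rpow_add (by norm_num)]; simp
    _ ≤ _ := by gcongr

/-- The probability that a memoryless channel turns `x` into `y`, in terms of the conditional
divergence and entropy of the joint type. -/
lemma prod_channel_le {W : X → Y → ℝ} (hW : ∀ a b, 0 ≤ W a b) (x : Fin n → X) (y : Fin n → Y)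
    {d : ℝ} (hd : (d : EReal) ≤ condDivergence (condType y x) W (seqType x)) :
    ∏ i, W (x i) (y i) ≤ (2 : ℝ) ^ (-(n : ℝ) * (d + empCondEntropy y x)) := by
  by_cases h0 : ∃ i, W (x i) (y i) = 0
  · obtain ⟨i, hi⟩ := h0
    rw [Finset.prod_eq_zero (Finset.mem_univ i) hi]
    positivity
  push Not at h0
  have hpos : ∀ i, 0 < W (x i) (y i) := fun i => lt_of_le_of_ne (hW _ _) (h0 i).symm
  have hac : ∀ b a, condType y x b a ≠ 0 → W b a ≠ 0 := by
    intro b a hba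
    have : seqType (fun i => (y i, x i)) (a, b) ≠ 0 := fun h => hba (by simp [condType, h])
    obtain ⟨i, hi⟩ := exists_of_seqType_ne_zero this
    simp only [Prod.mk.injEq] at hi
    rw [← hi.1, ← hi.2]
    exact h0 i
  rw [condDivergence, if_pos (fun b a _ hWz => by_contra fun h => hac b a h hWz),
    EReal.coe_le_coe_iff] at hd
  rw [prod_eq_two_rpow hpos]
  apply Real.rpow_le_rpow_of_exponent_le (by norm_num)
  rw [← sum_condType_mul y x (fun b a => Real.logb 2 (W b a)), neg_mul, ← mul_neg]
  apply mul_le_mul_of_nonneg_left _ (Nat.cast_nonneg n)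
  have key : ∑ b, ∑ a, condType y x b a * seqType x b * Real.logb 2 (W b a) =
      -(∑ b, seqType x b * ∑ a, condType y x b a * Real.logb 2 (condType y x b a / W b a))
        - empCondEntropy y x := by
    rw [empCondEntropy, condEntropy, ← Finset.sum_neg_distrib, ← Finset.sum_sub_distrib]
    refine Finset.sum_congr rfl fun b _ => ?_
    rw [Finset.mul_sum, ← Finset.sum_neg_distrib, ← Finset.sum_sub_distrib]
    refine Finset.sum_congr rfl fun a _ => ?_
    by_cases hz : condType y x b a = 0
    · simp [hz]
    · rw [Real.logb_div hz (hac b a hz), one_div, Real.logb_inv]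
      ring
  rw [key]
  linarith

end Types

/-! ### Closeness in divergence -/

section Divergence

/-- The scalar form of the comparison of divergence with the squared Hellinger distance. -/
lemma sq_sub_le_four_mul {p q : ℝ} (hp0 : 0 ≤ p) (hp1 : p ≤ 1) (hq0 : 0 ≤ q) (hq1 : q ≤ 1)
    (h : q = 0 → p = 0) :
    (p - q) ^ 2 ≤ 4 * (p * Real.log (p / q) - p + q) := by
  obtain ⟨s, hs0, rfl⟩ : ∃ s, 0 ≤ s ∧ s ^ 2 = p := ⟨√p, Real.sqrt_nonneg p, Real.sq_sqrt hp0⟩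
  obtain ⟨t, ht0, rfl⟩ : ∃ t, 0 ≤ t ∧ t ^ 2 = q := ⟨√q, Real.sqrt_nonneg q, Real.sq_sqrt hq0⟩
  have hs1 : s ≤ 1 := by nlinarith
  have ht1 : t ≤ 1 := by nlinarith
  have h1 : (s - t) ^ 2 ≤ s ^ 2 * Real.log (s ^ 2 / t ^ 2) - s ^ 2 + t ^ 2 := by
    rcases hs0.eq_or_lt with rfl | hs
    · simp
    have ht : 0 < t := by
      rcases ht0.eq_or_lt with rfl | ht
      · have := h (by simp)
        nlinarith
      · exact ht
    have h2 := Real.log_le_sub_one_of_pos (div_pos ht hs)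
    have h3 : Real.log (s ^ 2 / t ^ 2) = -2 * Real.log (t / s) := by
      rw [← div_pow, Real.log_pow, ← inv_div t s, Real.log_inv]
      push_cast
      ring
    have h4 : s ^ 2 * Real.log (t / s) ≤ s ^ 2 * (t / s - 1) := by gcongr
    have h5 : s ^ 2 * (t / s - 1) = s * t - s ^ 2 := by field_simp
    rw [h3]
    nlinarith
  have h6 : (s ^ 2 - t ^ 2) ^ 2 = (s + t) ^ 2 * (s - t) ^ 2 := by ring
  have h7 : (s + t) ^ 2 ≤ 4 := by nlinarith
  have h8 : (s + t) ^ 2 * (s - t) ^ 2 ≤ 4 * (s - t) ^ 2 := by gcongr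
  linarith

lemma IsPMF.le_one {U : Type*} [Fintype U] {p : U → ℝ} (hp : IsPMF p) (a : U) : p a ≤ 1 :=
  hp.2 ▸ Finset.single_le_sum (fun b _ => hp.1 b) (Finset.mem_univ a)

lemma sum_sq_sub_le {U : Type*} [Fintype U] {p q : U → ℝ} (hp : IsPMF p) (hq : IsPMF q)
    (h : ∀ a, q a = 0 → p a = 0) :
    ∑ a, (p a - q a) ^ 2 ≤ 4 * ∑ a, p a * Real.logb 2 (p a / q a) := by
  have h1 : ∑ a, (p a - q a) ^ 2 ≤ 4 * ∑ a, p a * Real.log (p a / q a) := by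
    calc ∑ a, (p a - q a) ^ 2 ≤ ∑ a, 4 * (p a * Real.log (p a / q a) - p a + q a) :=
          Finset.sum_le_sum fun a _ =>
            sq_sub_le_four_mul (hp.1 a) (hp.le_one a) (hq.1 a) (hq.le_one a) (h a)
      _ = 4 * ∑ a, p a * Real.log (p a / q a) := by
          rw [← Finset.mul_sum, Finset.sum_add_distrib, Finset.sum_sub_distrib, hp.2, hq.2]
          ring
  have h2 : ∑ a, p a * Real.logb 2 (p a / q a) =
      (∑ a, p a * Real.log (p a / q a)) / Real.log 2 := by
    rw [Finset.sum_div]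
    exact Finset.sum_congr rfl fun a _ => by rw [Real.logb, mul_div_assoc]
  have h3 : 0 ≤ ∑ a, (p a - q a) ^ 2 := Finset.sum_nonneg fun a _ => sq_nonneg _
  have h4 : Real.log 2 ≤ 1 := by linarith [Real.log_two_lt_d9]
  have h5 : 0 < Real.log 2 := Real.log_pos (by norm_num)
  rw [h2]
  refine h1.trans (mul_le_mul_of_nonneg_left ?_ (by norm_num))
  rw [le_div_iff₀ h5]
  nlinarith

lemma sum_sq_sub_le_of_divergence_le {U : Type*} [Fintype U] {p q : U → ℝ} (hp : IsPMF p)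
    (hq : IsPMF q) {γ : ℝ} (h : divergence p q ≤ (γ : EReal)) :
    (∀ a, q a = 0 → p a = 0) ∧ ∑ a, (p a - q a) ^ 2 ≤ 4 * γ := by
  unfold divergence at h
  split_ifs at h with hac
  · rw [EReal.coe_le_coe_iff] at h
    exact ⟨hac, (sum_sq_sub_le hp hq hac).trans (by linarith)⟩
  · exact absurd h (by simp)

lemma abs_sub_le_of_divergence_le {U : Type*} [Fintype U] {p q : U → ℝ} (hp : IsPMF p)
    (hq : IsPMF q) {t : ℝ} (ht : 0 ≤ t) (h : divergence p q ≤ ((t ^ 2 : ℝ) : EReal)) (a : U) :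
    |p a - q a| ≤ 2 * t := by
  apply abs_le_of_sq_le_sq _ (by positivity)
  have := Finset.single_le_sum (f := fun a => (p a - q a) ^ 2) (fun a _ => sq_nonneg _)
    (Finset.mem_univ a)
  have h2 := (sum_sq_sub_le_of_divergence_le hp hq h).2
  nlinarith

lemma sum_mul_sum_sq_sub_le {U V : Type*} [Fintype U] [Fintype V] {p : V → ℝ} (hp : ∀ b, 0 ≤ p b)
    {q W : V → U → ℝ} (hq : ∀ b, p b ≠ 0 → IsPMF (q b)) (hW : IsChannel W)
    (h : ∀ b a, p b ≠ 0 → W b a = 0 → q b a = 0) :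
    ∑ b, p b * ∑ a, (q b a - W b a) ^ 2 ≤
      4 * ∑ b, p b * ∑ a, q b a * Real.logb 2 (q b a / W b a) := by
  rw [Finset.mul_sum]
  refine Finset.sum_le_sum fun b _ => ?_
  by_cases hb : p b = 0
  · simp [hb]
  · rw [mul_left_comm]
    exact mul_le_mul_of_nonneg_left (sum_sq_sub_le (hq b hb) (hW b) fun a => h b a hb) (hp b)

lemma isPMF_condType {X Y : Type*} [Fintype X] [Fintype Y] {n : ℕ} (x : Fin n → X)
    (y : Fin n → Y) {b : Y} (hb : seqType y b ≠ 0) : IsPMF (condType x y b) :=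
  ⟨condType_nonneg x y b, sum_condType x y hb⟩

end Divergence

/-! ### Continuity of the conditional entropy -/

section Continuity

/-- The function `p ↦ p log (1/p)`. -/
def entropyTerm (p : ℝ) : ℝ := p * Real.logb 2 (1 / p)

lemma entropyTerm_eq (p : ℝ) : entropyTerm p = Real.negMulLog p / Real.log 2 := by
  rw [entropyTerm, one_div, Real.logb_inv, Real.logb, Real.negMulLog]
  ring

lemma continuous_entropyTerm : Continuous entropyTerm := by
  simp only [funext entropyTerm_eq]
  exact Real.continuous_negMulLog.div_const _

/-- The conditional entropy of the second coordinate given the first, as a function of the joint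
distribution: the joint entropy minus the entropy of the marginal. -/
def jointCondEntropy {X Y : Type*} [Fintype X] [Fintype Y] (P : Y → X → ℝ) : ℝ :=
  ∑ b, (∑ a, entropyTerm (P b a) - entropyTerm (∑ a, P b a))

variable {X Y : Type*} [Fintype X] [Fintype Y]

lemma continuous_jointCondEntropy :
    Continuous (jointCondEntropy : (Y → X → ℝ) → ℝ) := by
  unfold jointCondEntropy
  refine continuous_finsetSum _ fun b _ => Continuous.sub ?_ ?_
  · exact continuous_finsetSum _ fun a _ => continuous_entropyTerm.comp (by fun_prop)
  · exact continuous_entropyTerm.comp (by fun_prop)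

lemma condEntropy_eq_jointCondEntropy {P : Y → X → ℝ} (hP : ∀ b a, 0 ≤ P b a) :
    condEntropy (fun b a => P b a / ∑ a', P b a') (fun b => ∑ a, P b a) = jointCondEntropy P := by
  unfold condEntropy jointCondEntropy
  refine Finset.sum_congr rfl fun b _ => ?_
  by_cases hb : ∑ a, P b a = 0
  · have h0 := (Finset.sum_eq_zero_iff_of_nonneg fun a _ => hP b a).1 hb
    simp only [Finset.mem_univ, forall_const] at h0
    simp [h0, entropyTerm]
  · have h1 : entropyTerm (∑ a, P b a) = ∑ a, P b a * Real.logb 2 (1 / ∑ a, P b a) := by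
      rw [entropyTerm, Finset.sum_mul]
    rw [h1, ← Finset.sum_sub_distrib]
    refine Finset.sum_congr rfl fun a _ => ?_
    rw [div_mul_cancel₀ _ hb, entropyTerm]
    by_cases ha : P b a = 0
    · simp [ha]
    · rw [one_div_div, Real.logb_div hb ha, one_div, one_div, Real.logb_inv, Real.logb_inv]
      ring

lemma equivocation_eq {μX : X → ℝ} (hμ : IsPMF μX) {W : X → Y → ℝ} (hW : IsChannel W) :
    equivocation μX W = jointCondEntropy (fun b a => μX a * W a b) :=
  condEntropy_eq_jointCondEntropy fun b a => mul_nonneg (hμ.1 a) ((hW a).1 b)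

lemma empCondEntropy_eq {n : ℕ} (x : Fin n → X) (y : Fin n → Y) :
    empCondEntropy x y = jointCondEntropy (fun b a => seqType (fun i => (x i, y i)) (a, b)) := by
  rw [← condEntropy_eq_jointCondEntropy fun b a => seqType_nonneg _ _]
  simp only [sum_seqType_pair]
  rfl

lemma exists_jointCondEntropy_close {δ : ℝ} (hδ : 0 < δ) :
    ∃ η : ℝ, 0 < η ∧ ∀ P Q : Y → X → ℝ, (∀ b a, P b a ∈ Set.Icc (0 : ℝ) 1) →
      (∀ b a, Q b a ∈ Set.Icc (0 : ℝ) 1) → (∀ b a, |P b a - Q b a| < η) →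
      |jointCondEntropy P - jointCondEntropy Q| < δ := by
  have hu := (isCompact_Icc (a := (0 : Y → X → ℝ)) (b := 1)).uniformContinuousOn_of_continuous
    continuous_jointCondEntropy.continuousOn
  rw [Metric.uniformContinuousOn_iff] at hu
  obtain ⟨η, hη, h⟩ := hu δ hδ
  refine ⟨η, hη, fun P Q hP hQ hPQ => ?_⟩
  have := h P ⟨fun b a => (hP b a).1, fun b a => (hP b a).2⟩ Q
    ⟨fun b a => (hQ b a).1, fun b a => (hQ b a).2⟩ (by
      rw [dist_pi_lt_iff hη]
      intro b
      rw [dist_pi_lt_iff hη]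
      intro a
      exact hPQ b a)
  exact this

/-- The exponent is bounded away from zero, uniformly in the length, in the channels of
equivocation less than `R - δ` and in the input types close to the input distribution: if the
divergence is small then the joint type is close to the joint distribution of the channel, so the
empirical conditional entropy is close to the equivocation. -/
lemma exists_exponent_lower_bound {μX : X → ℝ} (hμ : IsPMF μX) (R : ℝ) {δ : ℝ} (hδ : 0 < δ) :
    ∃ ε : ℝ, 0 < ε ∧ ∃ γ : ℝ, 0 < γ ∧ ∀ n : ℕ, n ≠ 0 → ∀ (x : Fin n → X) (y : Fin n → Y)
      (W : X → Y → ℝ), IsChannel W → divergence (seqType x) μX ≤ (γ : EReal) →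
      equivocation μX W < R - δ →
      (ε : EReal) ≤ condDivergence (condType y x) W (seqType x) +
        ((max (R - empCondEntropy x y) 0 : ℝ) : EReal) := by
  obtain ⟨η, hη, hclose⟩ := exists_jointCondEntropy_close (X := X) (Y := Y) (half_pos hδ)
  refine ⟨min ((η / 5) ^ 2) (δ / 2), by positivity, (η / 5) ^ 2, by positivity, ?_⟩
  intro n hn x y W hW hD hE
  by_cases hac : ∀ b a, seqType x b ≠ 0 → W b a = 0 → condType y x b a = 0
  swap
  · rw [condDivergence, if_neg hac, EReal.top_add_coe]
    exact le_top
  rw [condDivergence, if_pos hac, ← EReal.coe_add, EReal.coe_le_coe_iff]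
  set D := ∑ b, seqType x b * ∑ a, condType y x b a * Real.logb 2 (condType y x b a / W b a)
    with hDdef
  have hS := sum_mul_sum_sq_sub_le (seqType_nonneg x) (fun b hb => isPMF_condType y x hb) hW hac
  rw [← hDdef] at hS
  have hnn : ∀ b, 0 ≤ seqType x b * ∑ a, (condType y x b a - W b a) ^ 2 := fun b =>
    mul_nonneg (seqType_nonneg x b) (Finset.sum_nonneg fun a _ => sq_nonneg _)
  have hD0 : 0 ≤ D := by
    have : 0 ≤ ∑ b, seqType x b * ∑ a, (condType y x b a - W b a) ^ 2 :=
      Finset.sum_nonneg fun b _ => hnn b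
    linarith
  have hpx := isPMF_seqType hn x
  by_cases hDs : (η / 5) ^ 2 ≤ D
  · exact (min_le_left _ _).trans (hDs.trans (le_add_of_nonneg_right (le_max_right _ _)))
  push Not at hDs
  have hjoint : ∀ b a, |seqType (fun i => (x i, y i)) (a, b) - μX a * W a b| < η := by
    intro b a
    have h1 := abs_sub_le_of_divergence_le hpx hμ (by positivity) hD a
    have h2 : |seqType x a * (condType y x a b - W a b)| ≤ 2 * (η / 5) := by
      apply abs_le_of_sq_le_sq _ (by positivity)
      have h3 := Finset.single_le_sum (f := fun b => (condType y x a b - W a b) ^ 2)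
        (fun b _ => sq_nonneg _) (Finset.mem_univ b)
      have h4 := Finset.single_le_sum
        (f := fun a => seqType x a * ∑ b, (condType y x a b - W a b) ^ 2)
        (fun b _ => hnn b) (Finset.mem_univ a)
      have h5 := hpx.le_one a
      have h6 := hpx.1 a
      calc (seqType x a * (condType y x a b - W a b)) ^ 2
          = seqType x a * (seqType x a * (condType y x a b - W a b) ^ 2) := by ring
        _ ≤ 1 * (seqType x a * ∑ b, (condType y x a b - W a b) ^ 2) := by gcongr
        _ ≤ (2 * (η / 5)) ^ 2 := by nlinarith
    have h7 : |(seqType x a - μX a) * W a b| ≤ 2 * (η / 5) := by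
      rw [abs_mul, abs_of_nonneg ((hW a).1 b)]
      calc _ ≤ |seqType x a - μX a| * 1 := by gcongr; exact (hW a).le_one b
        _ ≤ _ := by rw [mul_one]; exact h1
    have h8 : seqType (fun i => (x i, y i)) (a, b) - μX a * W a b =
        seqType x a * (condType y x a b - W a b) + (seqType x a - μX a) * W a b := by
      rw [← seqType_swap, ← condType_mul_seqType y x]
      ring
    rw [h8]
    refine (abs_add_le _ _).trans_lt ?_
    linarith
  have hpxy := isPMF_seqType hn (fun i => (x i, y i))
  have := hclose (fun b a => seqType (fun i => (x i, y i)) (a, b)) (fun b a => μX a * W a b)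
    (fun b a => ⟨hpxy.1 _, hpxy.le_one _⟩)
    (fun b a => ⟨mul_nonneg (hμ.1 a) ((hW a).1 b),
      mul_le_one₀ (hμ.le_one a) ((hW a).1 b) ((hW a).le_one b)⟩) hjoint
  rw [← empCondEntropy_eq, ← equivocation_eq hμ hW, abs_lt] at this
  refine (min_le_right _ _).trans (le_trans ?_ (le_add_of_nonneg_left hD0))
  exact le_trans (by linarith) (le_max_left _ _)

end Continuity

/-! ### The number of sequences close to the input distribution -/

section Typical

variable {X : Type*} [Fintype X]

lemma prod_le_two_rpow_of_le_divergence {n : ℕ} (hn : n ≠ 0) {μX : X → ℝ} (hμ : IsPMF μX)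
    (x : Fin n → X) {γ : ℝ} (h : (γ : EReal) ≤ divergence (seqType x) μX) :
    ∏ i, μX (x i) ≤ (2 : ℝ) ^ (-(n : ℝ) * (γ + empCondEntropy x (fun _ => ()))) := by
  refine prod_channel_le (W := fun _ : Unit => μX) (fun _ a => hμ.1 a) (fun _ => ()) x
    (h.trans (le_of_eq ?_))
  have h1 : seqType (fun _ : Fin n => ()) () = 1 := by
    simpa using sum_seqType hn (fun _ : Fin n => ())
  have h2 : condType x (fun _ => ()) () = seqType x := by
    funext a
    rw [condType, h1, div_one]
    unfold seqType
    congr 3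
    ext i
    simp
  simp [divergence, condDivergence, h1, h2]

lemma prod_le_two_rpow_sum {n : ℕ} {μX : X → ℝ} (hμ : IsPMF μX) (x : Fin n → X) :
    ∏ i, μX (x i) ≤ (2 : ℝ) ^ (-(n : ℝ) * ∑ a, seqType x a * Real.logb 2 (1 / μX a)) := by
  by_cases h0 : ∃ i, μX (x i) = 0
  · obtain ⟨i, hi⟩ := h0
    rw [Finset.prod_eq_zero (Finset.mem_univ i) hi]
    positivity
  push Not at h0
  rw [prod_eq_two_rpow fun i => lt_of_le_of_ne (hμ.1 _) (h0 i).symm, neg_mul, sum_seqType_mul,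
    ← Finset.sum_neg_distrib]
  simp

lemma tendsto_poly_mul_two_rpow (k : ℕ) {c : ℝ} (hc : 0 < c) :
    Tendsto (fun n : ℕ => ((n : ℝ) + 1) ^ k * (2 : ℝ) ^ (-(n : ℝ) * c)) atTop (𝓝 0) := by
  have hr : (2 : ℝ) ^ (-c) < 1 := Real.rpow_lt_one_of_one_lt_of_neg (by norm_num) (by linarith)
  have h := (tendsto_pow_const_mul_const_pow_of_lt_one k (by positivity) hr).comp
    (tendsto_add_atTop_nat 1)
  have h2 := h.mul_const ((2 : ℝ) ^ c)
  rw [zero_mul] at h2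
  refine h2.congr fun n => ?_
  simp only [Function.comp]
  rw [← Real.rpow_natCast ((2 : ℝ) ^ (-c)) (n + 1), ← Real.rpow_mul (by norm_num), mul_assoc,
    ← Real.rpow_add (by norm_num)]
  push_cast
  ring_nf

open Classical in
/-- Sequences whose type is within any fixed divergence of `μX` have total probability close to
one, and each of them has probability about `2^{-nH}`. -/
lemma eventually_le_card_divergence_le {μX : X → ℝ} (hμ : IsPMF μX) {γ s : ℝ} (hγ : 0 < γ)
    (hs : 0 < s) :
    ∀ᶠ n : ℕ in atTop, (2 : ℝ) ^ ((n : ℝ) * (entropy μX - s)) ≤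
      ((Finset.univ.filter fun x : Fin n → X =>
        divergence (seqType x) μX ≤ (γ : EReal)).card : ℝ) := by
  set L := ∑ a, |Real.logb 2 (1 / μX a)| with hL
  have hL0 : 0 ≤ L := Finset.sum_nonneg fun a _ => abs_nonneg _
  -- `t` is small enough for the linear functional `∑ a, ν a * log (1 / μ a)` to vary by `s / 2`
  obtain ⟨t, ht0, htL, htγ⟩ : ∃ t : ℝ, 0 < t ∧ 2 * t * L ≤ s / 2 ∧ t ^ 2 ≤ γ := by
    refine ⟨min (s / (4 * (L + 1))) (√γ), by positivity, ?_, ?_⟩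
    · calc 2 * min (s / (4 * (L + 1))) (√γ) * L ≤ 2 * (s / (4 * (L + 1))) * (L + 1) := by
            gcongr
            · exact min_le_left _ _
            · linarith
        _ = s / 2 := by field_simp; norm_num
    · calc min (s / (4 * (L + 1))) (√γ) ^ 2 ≤ (√γ) ^ 2 := by
            gcongr
            exact min_le_right _ _
        _ = γ := Real.sq_sqrt hγ.le
  have h1 := tendsto_poly_mul_two_rpow (Fintype.card X * Fintype.card Unit) (pow_pos ht0 2)
  have h2 := tendsto_poly_mul_two_rpow 0 (half_pos hs)
  filter_upwards [h1.eventually_lt_const (show (0 : ℝ) < 1 / 2 by norm_num),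
    h2.eventually_lt_const (show (0 : ℝ) < 1 / 2 by norm_num), eventually_ne_atTop 0]
    with n hn1 hn2 hn0
  rw [pow_zero, one_mul] at hn2
  set G := Finset.univ.filter fun x : Fin n → X =>
    divergence (seqType x) μX ≤ ((t ^ 2 : ℝ) : EReal) with hG
  have hfar : ∑ x ∈ Finset.univ.filter (fun x : Fin n → X =>
      ¬ divergence (seqType x) μX ≤ ((t ^ 2 : ℝ) : EReal)), ∏ i, μX (x i) ≤ 1 / 2 := by
    refine le_trans ?_ hn1.le
    calc _ ≤ ∑ x ∈ Finset.univ.filter (fun x : Fin n → X =>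
          ¬ divergence (seqType x) μX ≤ ((t ^ 2 : ℝ) : EReal)),
          (2 : ℝ) ^ (-(n : ℝ) * empCondEntropy x (fun _ => ())) *
            (2 : ℝ) ^ (-(n : ℝ) * t ^ 2) := by
          refine Finset.sum_le_sum fun x hx => ?_
          refine (prod_le_two_rpow_of_le_divergence hn0 hμ x
            (le_of_not_ge (Finset.mem_filter.1 hx).2)).trans (le_of_eq ?_)
          rw [← Real.rpow_add (by norm_num)]
          ring_nf
      _ ≤ ∑ x : Fin n → X, (2 : ℝ) ^ (-(n : ℝ) * empCondEntropy x (fun _ => ())) *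
            (2 : ℝ) ^ (-(n : ℝ) * t ^ 2) :=
          Finset.sum_le_sum_of_subset_of_nonneg (Finset.subset_univ _)
            fun x _ _ => by positivity
      _ ≤ _ := by
          rw [← Finset.sum_mul]
          gcongr
          exact sum_two_rpow_neg_empCondEntropy_le _
  have htot : ∑ x : Fin n → X, ∏ i, μX (x i) = 1 := by
    rw [← Fintype.prod_sum (fun (_ : Fin n) a => μX a)]
    simp [hμ.2]
  have hnear : 1 / 2 ≤ ∑ x ∈ G, ∏ i, μX (x i) := by
    have := Finset.sum_filter_add_sum_filter_not Finset.univ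
      (fun x : Fin n → X => divergence (seqType x) μX ≤ ((t ^ 2 : ℝ) : EReal))
      (fun x => ∏ i, μX (x i))
    rw [htot] at this
    linarith
  have heach : ∀ x ∈ G, ∏ i, μX (x i) ≤ (2 : ℝ) ^ (-(n : ℝ) * (entropy μX - s / 2)) := by
    intro x hx
    refine (prod_le_two_rpow_sum hμ x).trans ?_
    apply Real.rpow_le_rpow_of_exponent_le (by norm_num)
    rw [neg_mul, neg_mul, neg_le_neg_iff]
    apply mul_le_mul_of_nonneg_left _ (Nat.cast_nonneg n)
    have hx' := abs_sub_le_of_divergence_le (isPMF_seqType hn0 x) hμ ht0.le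
      (Finset.mem_filter.1 hx).2
    have : entropy μX - ∑ a, seqType x a * Real.logb 2 (1 / μX a) ≤ 2 * t * L := by
      rw [entropy, ← Finset.sum_sub_distrib, hL, Finset.mul_sum]
      refine Finset.sum_le_sum fun a _ => ?_
      rw [← sub_mul]
      refine (le_abs_self _).trans ?_
      rw [abs_mul, abs_sub_comm]
      exact mul_le_mul_of_nonneg_right (hx' a) (abs_nonneg _)
    linarith
  have hcard : (1 / 2 : ℝ) ≤ (G.card : ℝ) * (2 : ℝ) ^ (-(n : ℝ) * (entropy μX - s / 2)) := by
    refine hnear.trans ((Finset.sum_le_sum heach).trans (le_of_eq ?_))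
    rw [Finset.sum_const, nsmul_eq_mul]
  calc (2 : ℝ) ^ ((n : ℝ) * (entropy μX - s))
      = (2 : ℝ) ^ (-(n : ℝ) * (s / 2)) * (2 : ℝ) ^ ((n : ℝ) * (entropy μX - s / 2)) := by
        rw [← Real.rpow_add (by norm_num)]
        ring_nf
    _ ≤ ((G.card : ℝ) * (2 : ℝ) ^ (-(n : ℝ) * (entropy μX - s / 2))) *
          (2 : ℝ) ^ ((n : ℝ) * (entropy μX - s / 2)) := by
        gcongr
        linarith
    _ = G.card := by
        rw [mul_assoc, ← Real.rpow_add (by norm_num)]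
        simp
    _ ≤ _ := by
        norm_cast
        apply Finset.card_le_card
        intro x hx
        rw [Finset.mem_filter] at hx ⊢
        exact ⟨hx.1, hx.2.trans (EReal.coe_le_coe_iff.2 htγ)⟩

end Typical

/-! ### Random choice from an ensemble -/

section Ensembles

variable {D C : Type*} (E : Ensemble D C)

lemma Ensemble.exists_le {f : (D → C) → ℝ} {K : ℝ} (h : ∑ A ∈ E.fns, E.prob A * f A ≤ K) :
    ∃ A ∈ E.fns, f A ≤ K := by
  by_contra! hc
  have h1 : ∑ A ∈ E.fns, E.prob A * (f A - K) ≤ 0 := by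
    simp only [mul_sub, Finset.sum_sub_distrib, ← Finset.sum_mul, E.sum_prob]
    linarith
  have h2 : ∀ A ∈ E.fns, 0 ≤ E.prob A * (f A - K) := fun A hA =>
    mul_nonneg (E.prob_nonneg A hA) (sub_nonneg.2 (hc A hA).le)
  have h3 := (Finset.sum_eq_zero_iff_of_nonneg h2).1 (le_antisymm h1 (Finset.sum_nonneg h2))
  have h4 : ∑ A ∈ E.fns, E.prob A = 0 := Finset.sum_eq_zero fun A hA =>
    (mul_eq_zero.1 (h3 A hA)).resolve_right (sub_pos.2 (hc A hA)).ne'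
  rw [E.sum_prob] at h4
  exact one_ne_zero h4

lemma Ensemble.fns_nonempty : E.fns.Nonempty := by
  by_contra h
  have := E.sum_prob
  rw [Finset.not_nonempty_iff_eq_empty.1 h, Finset.sum_empty] at this
  exact zero_ne_one this

lemma Ensemble.collision_eq [DecidableEq C] (x x' : D) :
    E.collision x x' = ∑ A ∈ E.fns, E.prob A * if A x = A x' then 1 else 0 := by
  simp only [Ensemble.collision, Finset.sum_filter, mul_ite, mul_one, mul_zero]
  congr!

lemma Ensemble.collision_self (x : D) : E.collision x x = 1 := by
  classical
  simp [E.collision_eq, E.sum_prob]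

open Classical in
/-- The indicator that `A` maps `x` to the same value as some element of `S`. -/
def hits (A : D → C) (x : D) (S : Finset D) : ℝ := if ∃ x' ∈ S, A x = A x' then 1 else 0

lemma hits_nonneg (A : D → C) (x : D) (S : Finset D) : 0 ≤ hits A x S := by
  unfold hits; split_ifs <;> norm_num

lemma hits_le_one (A : D → C) (x : D) (S : Finset D) : hits A x S ≤ 1 := by
  unfold hits; split_ifs <;> norm_num

lemma hits_eq_one {A : D → C} {x x' : D} {S : Finset D} (h : x' ∈ S) (hA : A x = A x') :
    hits A x S = 1 := if_pos ⟨x', h, hA⟩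

lemma Ensemble.sum_hits_le_one (x : D) (S : Finset D) :
    ∑ A ∈ E.fns, E.prob A * hits A x S ≤ 1 := by
  rw [← E.sum_prob]
  exact Finset.sum_le_sum fun A hA =>
    mul_le_of_le_one_right (E.prob_nonneg A hA) (hits_le_one A x S)

lemma Ensemble.sum_hits_le (x : D) (S : Finset D) :
    ∑ A ∈ E.fns, E.prob A * hits A x S ≤ ∑ x' ∈ S, E.collision x x' := by
  classical
  simp only [E.collision_eq]
  rw [Finset.sum_comm]
  refine Finset.sum_le_sum fun A hA => ?_
  rw [← Finset.mul_sum]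
  refine mul_le_mul_of_nonneg_left ?_ (E.prob_nonneg A hA)
  by_cases h : ∃ x' ∈ S, A x = A x'
  · obtain ⟨x', hx', hA'⟩ := h
    rw [hits_eq_one hx' hA']
    refine le_trans (by simp [hA']) (Finset.single_le_sum
      (f := fun x' => if A x = A x' then (1 : ℝ) else 0) (fun i _ => ?_) hx')
    split_ifs <;> norm_num
  · rw [hits, if_neg h]
    exact Finset.sum_nonneg fun i _ => by split_ifs <;> norm_num

open Classical in
/-- The values in `I` that `F` does not take on `T`. -/
def missed (I : Finset C) (F : D → C) (T : Finset D) : Finset C :=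
  I.filter fun v => ∀ x ∈ T, F x ≠ v

open Classical in
/-- The elements of `T` with value `c` under `A`. -/
def fiberIn (T : Finset D) (A : D → C) (c : C) : Finset D := T.filter fun x => A x = c

variable [Fintype C]

open Classical in
/-- The image of an ensemble, as a finite set. -/
def Ensemble.imF : Finset C := Finset.univ.filter (· ∈ E.im)

lemma Ensemble.mem_imF {c : C} : c ∈ E.imF ↔ c ∈ E.im := by simp [Ensemble.imF]

lemma Ensemble.ncard_im : E.im.ncard = E.imF.card := by
  rw [← Set.ncard_coe_finset]
  congr 1
  ext c
  simp [E.mem_imF]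

lemma Ensemble.apply_mem_imF {A : D → C} (hA : A ∈ E.fns) (x : D) : A x ∈ E.imF :=
  E.mem_imF.2 ⟨A, hA, x, rfl⟩

lemma Ensemble.imF_card_pos [Nonempty D] : 0 < E.imF.card := by
  obtain ⟨A, hA⟩ := E.fns_nonempty
  exact Finset.card_pos.2 ⟨_, E.apply_mem_imF hA (Classical.arbitrary D)⟩

/-- A set larger than the image by a factor meets most of the fibres of a random function: this
is Chebyshev's inequality for the number of elements of `T` in a fibre, whose second moment is
the expected number of collisions in `T`. -/
lemma Ensemble.sum_card_empty_fiber_le [Nonempty D] {T : Finset D} (hT : T.Nonempty) {α β : ℝ}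
    (hcol : ∑ x ∈ T, ∑ x' ∈ T, E.collision x x' ≤
      (T.card : ℝ) + (T.card : ℝ) * (T.card : ℝ) * α / (E.imF.card : ℝ) + (T.card : ℝ) * β) :
    ∑ A ∈ E.fns, E.prob A * ((missed E.imF A T).card : ℝ) ≤
      (E.imF.card : ℝ) * (α - 1 + (1 + β) * (E.imF.card : ℝ) / T.card) := by
  classical
  set M : ℝ := (E.imF.card : ℝ) with hM
  set s : ℝ := (T.card : ℝ) with hs
  have hM0 : 0 < M := by rw [hM]; exact_mod_cast E.imF_card_pos
  have hs0 : 0 < s := by rw [hs]; exact_mod_cast hT.card_pos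
  have hone : ∀ A ∈ E.fns, ((missed E.imF A T).card : ℝ) ≤
      (M / s) ^ 2 * (∑ x ∈ T, ∑ x' ∈ T, if A x = A x' then 1 else 0) - M := by
    intro A hA
    let N : C → ℝ := fun v => ∑ x ∈ T, if A x = v then 1 else 0
    have hN1 : ∑ v ∈ E.imF, N v = s := by
      simp only [N]
      rw [Finset.sum_comm, hs, Finset.card_eq_sum_ones]
      push_cast
      refine Finset.sum_congr rfl fun x _ => ?_
      rw [Finset.sum_ite_eq, if_pos (E.apply_mem_imF hA x)]
    have hN2 : ∑ v ∈ E.imF, N v ^ 2 = ∑ x ∈ T, ∑ x' ∈ T, if A x = A x' then (1 : ℝ) else 0 := by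
      have : ∀ v, N v ^ 2 = ∑ x ∈ T, ∑ x' ∈ T, if A x = v then (if A x' = v then (1 : ℝ) else 0)
          else 0 := by
        intro v
        simp only [N, sq, Finset.sum_mul_sum]
        refine Finset.sum_congr rfl fun x _ => Finset.sum_congr rfl fun x' _ => ?_
        split_ifs <;> simp
      simp only [this]
      rw [Finset.sum_comm]
      refine Finset.sum_congr rfl fun x _ => ?_
      rw [Finset.sum_comm]
      refine Finset.sum_congr rfl fun x' _ => ?_
      rw [Finset.sum_ite_eq, if_pos (E.apply_mem_imF hA x)]
      congr 1
      exact propext eq_comm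
    have h1 : ((missed E.imF A T).card : ℝ) ≤
        ∑ v ∈ E.imF, (M / s * N v - 1) ^ 2 := by
      rw [missed, Finset.card_eq_sum_ones, Finset.sum_filter]
      push_cast
      refine Finset.sum_le_sum fun v _ => ?_
      split_ifs with h
      · have : N v = 0 := Finset.sum_eq_zero fun x hx => if_neg (h x hx)
        simp [this]
      · positivity
    refine h1.trans (le_of_eq ?_)
    calc ∑ v ∈ E.imF, (M / s * N v - 1) ^ 2
        = ∑ v ∈ E.imF, ((M / s) ^ 2 * N v ^ 2 - 2 * (M / s) * N v + 1) :=
          Finset.sum_congr rfl fun v _ => by ring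
      _ = (M / s) ^ 2 * ∑ v ∈ E.imF, N v ^ 2 - 2 * (M / s) * ∑ v ∈ E.imF, N v + M := by
          rw [Finset.sum_add_distrib, Finset.sum_sub_distrib, Finset.mul_sum, Finset.mul_sum]
          simp [hM]
      _ = _ := by
          rw [hN1, hN2]
          field_simp
          ring
  calc _ ≤ ∑ A ∈ E.fns, E.prob A *
        ((M / s) ^ 2 * (∑ x ∈ T, ∑ x' ∈ T, if A x = A x' then 1 else 0) - M) :=
        Finset.sum_le_sum fun A hA =>
          mul_le_mul_of_nonneg_left (hone A hA) (E.prob_nonneg A hA)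
    _ = (M / s) ^ 2 * (∑ x ∈ T, ∑ x' ∈ T, E.collision x x') - M := by
        simp only [mul_sub, Finset.sum_sub_distrib, ← Finset.sum_mul, E.sum_prob, one_mul,
          E.collision_eq]
        congr 1
        simp only [mul_left_comm _ ((M / s) ^ 2)]
        rw [← Finset.mul_sum]
        congr 1
        simp only [Finset.mul_sum]
        rw [Finset.sum_comm]
        exact Finset.sum_congr rfl fun x _ => Finset.sum_comm
    _ ≤ (M / s) ^ 2 * (s + s * s * α / M + s * β) - M := by gcongr
    _ = _ := by
        field_simp
        ring

end Ensembles

section Pairs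

variable {D C C' : Type*} (E : Ensemble D C) (E' : Ensemble D C')

lemma Ensemble.sum_prod (f : (D → C × C') → ℝ) :
    ∑ F ∈ (E.prod E').fns, (E.prod E').prob F * f F =
      ∑ A ∈ E.fns, ∑ B ∈ E'.fns, E.prob A * E'.prob B * f (fun x => (A x, B x)) := by
  rw [Ensemble.prod, Finset.sum_map, Finset.sum_product]
  rfl

lemma Ensemble.range_snd [Nonempty D] (him : (E.prod E').im = E.im ×ˢ E'.im)
    (hr : ∀ F ∈ (E.prod E').fns, Set.range F = (E.prod E').im) {B : D → C'}
    (hB : B ∈ E'.fns) : Set.range B = E'.im := by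
  obtain ⟨A, hA⟩ := E.fns_nonempty
  have h := hr (fun x => (A x, B x)) (Finset.mem_map.2 ⟨(A, B), Finset.mem_product.2 ⟨hA, hB⟩, rfl⟩)
  rw [him] at h
  refine Set.Subset.antisymm (by rintro _ ⟨x, rfl⟩; exact ⟨B, hB, x, rfl⟩) fun m hm => ?_
  have : (A (Classical.arbitrary D), m) ∈ Set.range (fun x => (A x, B x)) := by
    rw [h]
    exact ⟨⟨A, hA, _, rfl⟩, hm⟩
  obtain ⟨x, hx⟩ := this
  exact ⟨x, (Prod.ext_iff.1 hx).2⟩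

variable [Fintype C] [Fintype C']

lemma Ensemble.imF_prod (him : (E.prod E').im = E.im ×ˢ E'.im) :
    (E.prod E').imF = E.imF ×ˢ E'.imF := by
  ext p
  rw [Ensemble.mem_imF, him, Finset.mem_product, E.mem_imF, E'.mem_imF]
  rfl

/-- The random choice of the two functions and of the value `c`: if the fibres that miss `T` are
few in the mean and if the weight `φ A x` has small mean for each `x ∈ T`, then some choice
has both few such fibres over `c` and a small total weight over the elements of `T` above `c`. -/
lemma Ensemble.exists_choice [Nonempty D] (him : (E.prod E').im = E.im ×ˢ E'.im)
    (T : Finset D) (φ : (D → C) → D → ℝ) {K₁ K₂ : ℝ}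
    (h₁ : ∑ F ∈ (E.prod E').fns, (E.prod E').prob F *
      ((missed (E.prod E').imF F T).card : ℝ) ≤
        ((E.prod E').imF.card : ℝ) * K₁)
    (h₂ : ∀ x ∈ T, ∑ A ∈ E.fns, E.prob A * φ A x ≤ K₂) :
    ∃ A ∈ E.fns, ∃ B ∈ E'.fns, ∃ c ∈ E.imF,
      1 / (E'.imF.card : ℝ) * (((missed E'.imF B (fiberIn T A c)).card : ℝ) +
        ∑ x ∈ fiberIn T A c, φ A x) ≤
      K₁ + (T.card : ℝ) / ((E.prod E').imF.card : ℝ) * K₂ := by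
  classical
  have hMA : (0 : ℝ) < E.imF.card := by exact_mod_cast E.imF_card_pos
  have hMB : (0 : ℝ) < E'.imF.card := by exact_mod_cast E'.imF_card_pos
  let z : (D → C) → (D → C') → C → ℝ := fun A B c =>
    ((missed E'.imF B (fiberIn T A c)).card : ℝ) +
        ∑ x ∈ fiberIn T A c, φ A x
  have hM : ((E.prod E').imF.card : ℝ) = E.imF.card * E'.imF.card := by
    rw [E.imF_prod E' him, Finset.card_product]
    push_cast
    rfl
  have hz : ∀ A ∈ E.fns, ∀ B, ∑ c ∈ E.imF, z A B c =
      ((missed (E.prod E').imF (fun x => (A x, B x)) T).card : ℝ) +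
        ∑ x ∈ T, φ A x := by
    intro A hA B
    simp only [z, Finset.sum_add_distrib]
    congr 1
    · rw [E.imF_prod E' him]
      simp only [missed, Finset.card_eq_sum_ones, Finset.sum_filter, Finset.sum_product]
      push_cast
      refine Finset.sum_congr rfl fun c _ => Finset.sum_congr rfl fun m _ => ?_
      simp [fiberIn, Prod.ext_iff]
    · simp only [fiberIn]
      exact Finset.sum_fiberwise_of_maps_to (fun x _ => E.apply_mem_imF hA x) _
  have hsum : ∑ A ∈ E.fns, E.prob A * ∑ B ∈ E'.fns, E'.prob B * ∑ c ∈ E.imF, z A B c ≤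
      (E.imF.card * E'.imF.card : ℝ) * K₁ + (T.card : ℝ) * K₂ := by
    have hsplit : ∑ A ∈ E.fns, E.prob A * ∑ B ∈ E'.fns, E'.prob B * ∑ c ∈ E.imF, z A B c =
        ∑ F ∈ (E.prod E').fns, (E.prod E').prob F *
          ((missed (E.prod E').imF F T).card : ℝ) +
        ∑ x ∈ T, ∑ A ∈ E.fns, E.prob A * φ A x := by
      rw [Ensemble.sum_prod E E' (fun F =>
        ((missed (E.prod E').imF F T).card : ℝ)), Finset.sum_comm (s := T),
        ← Finset.sum_add_distrib]
      refine Finset.sum_congr rfl fun A hA => ?_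
      simp only [hz A hA, mul_add, Finset.sum_add_distrib]
      rw [← Finset.sum_mul, E'.sum_prob, one_mul]
      simp only [Finset.mul_sum, mul_assoc]
    rw [hsplit, ← hM]
    refine add_le_add h₁ ((Finset.sum_le_sum h₂).trans (le_of_eq ?_))
    rw [Finset.sum_const, nsmul_eq_mul]
  obtain ⟨A, hA, h⟩ := E.exists_le hsum
  obtain ⟨B, hB, h⟩ := E'.exists_le h
  obtain ⟨c, hc, h⟩ : ∃ c ∈ E.imF, z A B c ≤
      ((E.imF.card * E'.imF.card : ℝ) * K₁ + (T.card : ℝ) * K₂) / E.imF.card := by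
    apply Finset.exists_le_of_sum_le (Finset.card_pos.1 E.imF_card_pos)
    refine h.trans (le_of_eq ?_)
    rw [Finset.sum_const, nsmul_eq_mul]
    field_simp
  refine ⟨A, hA, B, hB, c, hc, ?_⟩
  calc _ ≤ 1 / (E'.imF.card : ℝ) *
        (((E.imF.card * E'.imF.card : ℝ) * K₁ + (T.card : ℝ) * K₂) / E.imF.card) := by
        gcongr
    _ = _ := by
        rw [hM]
        field_simp

end Pairs

/-! ### The error probability of a code -/

section InitialSegments

/-- In a finite linearly ordered set there are initial segments of every size. -/
lemma exists_initialSegment {α β : Type*} [Fintype α] [LinearOrder β] (f : α → β)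
    (hf : Function.Injective f) (t : ℕ) (ht : t ≤ Fintype.card α) :
    ∃ T : Finset α, T.card = t ∧ ∀ x ∈ T, ∀ x' ∉ T, f x < f x' := by
  classical
  induction t with
  | zero => exact ⟨∅, by simp⟩
  | succ t ih =>
    obtain ⟨T, hT, hlt⟩ := ih (by omega)
    have hne : Tᶜ.Nonempty := by
      rw [← Finset.card_pos, Finset.card_compl]
      omega
    obtain ⟨z, hz, hmin⟩ := Finset.exists_min_image Tᶜ f hne
    rw [Finset.mem_compl] at hz
    refine ⟨insert z T, by rw [Finset.card_insert_of_notMem hz, hT], ?_⟩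
    intro x hx x' hx'
    rw [Finset.mem_insert, not_or] at hx'
    rcases Finset.mem_insert.1 hx with rfl | hx
    · exact lt_of_le_of_ne (hmin x' (Finset.mem_compl.2 hx'.2)) fun h => hx'.1 (hf h).symm
    · exact hlt x hx x' hx'.2

end InitialSegments

lemma sum_prod_channel {X Y : Type*} [Fintype Y] {n : ℕ} {W : X → Y → ℝ} (hW : IsChannel W)
    (x : Fin n → X) : ∑ y : Fin n → Y, ∏ i, W (x i) (y i) = 1 := by
  rw [← Fintype.prod_sum (fun i b => W (x i) b)]
  exact Finset.prod_eq_one fun i _ => (hW (x i)).2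

lemma messageError_le_one {X Y C' : Type*} [Fintype Y] {n : ℕ} {W : X → Y → ℝ}
    (hW : IsChannel W) (B : (Fin n → X) → C') (φ : C' → Option (Fin n → X))
    (g : (Fin n → Y) → (Fin n → X)) (m : C') : messageError W B φ g m ≤ 1 := by
  unfold messageError
  split
  · exact le_rfl
  · rename_i x _
    refine (Finset.sum_le_sum fun y _ => mul_le_of_le_one_right
      (Finset.prod_nonneg fun i _ => (hW _).1 _) ?_).trans (sum_prod_channel hW x).le
    split_ifs <;> norm_num

section Code

variable {X Y C C' : Type*} [Fintype X] [Fintype Y] {n : ℕ}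

/-- The position of a sequence in the preference order of the minimum-divergence encoder:
divergence first, enumeration second. -/
def encoderKey (μX : X → ℝ) (r : (Fin n → X) → ℕ) (x : Fin n → X) : EReal ×ₗ ℕ :=
  toLex (divergence (seqType x) μX, r x)

lemma encoderKey_injective (μX : X → ℝ) {r : (Fin n → X) → ℕ} (hr : Function.Injective r) :
    Function.Injective (encoderKey μX r) := fun _ _ h =>
  hr (Prod.ext_iff.1 (toLex.injective h)).2

lemma encoderKey_le_iff {μX : X → ℝ} {r : (Fin n → X) → ℕ} {x x' : Fin n → X} :
    encoderKey μX r x ≤ encoderKey μX r x' ↔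
      divergence (seqType x) μX < divergence (seqType x') μX ∨
        (divergence (seqType x) μX = divergence (seqType x') μX ∧ r x ≤ r x') :=
  Prod.Lex.toLex_le_toLex

/-- A code word is taken from the initial segment `T` of the preference order whenever the fibre
meets `T`. -/
lemma minDivEncoder_eq_some {μX : X → ℝ} {r : (Fin n → X) → ℕ} {T : Finset (Fin n → X)}
    (hT : ∀ x ∈ T, ∀ x' ∉ T, encoderKey μX r x < encoderKey μX r x')
    {A : (Fin n → X) → C} {B : (Fin n → X) → C'} {c : C} {m : C'}
    (h : ∃ x ∈ T, A x = c ∧ B x = m) :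
    ∃ x ∈ T, A x = c ∧ B x = m ∧ minDivEncoder μX r A B c m = some x := by
  classical
  obtain ⟨x₀, hx₀, hA₀, hB₀⟩ := h
  have hex : ∃ x, IsMinDivWord μX r A B c m x := by
    obtain ⟨x, hx, hmin⟩ := Finset.exists_min_image
      (Finset.univ.filter fun x => A x = c ∧ B x = m) (encoderKey μX r)
      ⟨x₀, by simp [hA₀, hB₀]⟩
    exact ⟨x, (Finset.mem_filter.1 hx).2, fun x' hA hB =>
      encoderKey_le_iff.1 (hmin x' (by simp [hA, hB]))⟩
  have hs := hex.choose_spec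
  refine ⟨hex.choose, ?_, hs.1.1, hs.1.2, by rw [minDivEncoder, dif_pos hex]⟩
  by_contra hmem
  exact absurd (hT x₀ hx₀ _ hmem) (not_lt.2 (encoderKey_le_iff.2 (hs.2 x₀ hA₀ hB₀)))

open Classical in
/-- The sequences outside `S` that the minimum-entropy decoder might prefer to `x` when `y` is
received. -/
def confusable (S : Finset (Fin n → X)) (x : Fin n → X) (y : Fin n → Y) : Finset (Fin n → X) :=
  Finset.univ.filter fun x' => x' ≠ x ∧ x' ∉ S ∧ empCondEntropy x' y ≤ empCondEntropy x y

lemma mem_confusable {S : Finset (Fin n → X)} {x x' : Fin n → X} {y : Fin n → Y} :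
    x' ∈ confusable S x y ↔ x' ≠ x ∧ x' ∉ S ∧ empCondEntropy x' y ≤ empCondEntropy x y := by
  simp [confusable]

/-- A weight on output sequences which, up to the factor `2^{-nε}`, dominates the transition
probabilities of every channel for which the exponent of the joint type of `x` and `y` is
at least `ε`. -/
def outputWeight (R : ℝ) (x : Fin n → X) (y : Fin n → Y) : ℝ :=
  (2 : ℝ) ^ ((n : ℝ) * (max (R - empCondEntropy x y) 0 - empCondEntropy y x))

lemma outputWeight_pos (R : ℝ) (x : Fin n → X) (y : Fin n → Y) : 0 < outputWeight R x y := by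
  unfold outputWeight; positivity

lemma prod_le_outputWeight {W : X → Y → ℝ} (hW : IsChannel W) {R ε : ℝ} {x : Fin n → X}
    {y : Fin n → Y} (h : (ε : EReal) ≤ condDivergence (condType y x) W (seqType x) +
      ((max (R - empCondEntropy x y) 0 : ℝ) : EReal)) :
    ∏ i, W (x i) (y i) ≤ (2 : ℝ) ^ (-(n : ℝ) * ε) * outputWeight R x y := by
  have hd : ((ε - max (R - empCondEntropy x y) 0 : ℝ) : EReal) ≤
      condDivergence (condType y x) W (seqType x) := by
    rw [EReal.coe_sub]
    exact EReal.sub_le_of_le_add h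
  refine (prod_channel_le (fun a b => (hW a).1 b) x y hd).trans (le_of_eq ?_)
  rw [outputWeight, ← Real.rpow_add (by norm_num)]
  ring_nf

/-- A bound for the probability that `x` is decoded wrongly, split according to whether the
competing sequence lies in `S`. -/
lemma sum_decoding_error_le {W : X → Y → ℝ} (hW : IsChannel W) {R ε : ℝ}
    {A : (Fin n → X) → C} {B : (Fin n → X) → C'} {c : C} {x : Fin n → X} (hx : A x = c)
    {g : (Fin n → Y) → (Fin n → X)} (hg : IsMinEntropyDecoder A c g) {m : C'} (hm : B x = m)
    (S : Finset (Fin n → X))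
    (hε : ∀ y : Fin n → Y, (ε : EReal) ≤ condDivergence (condType y x) W (seqType x) +
      ((max (R - empCondEntropy x y) 0 : ℝ) : EReal)) [DecidableEq C'] :
    ∑ y : Fin n → Y, (∏ i, W (x i) (y i)) * (if B (g y) = m then 0 else 1) ≤
      hits A x S + (2 : ℝ) ^ (-(n : ℝ) * ε) *
        ∑ y : Fin n → Y, outputWeight R x y * hits A x (confusable S x y) := by
  have hW0 : ∀ y : Fin n → Y, 0 ≤ ∏ i, W (x i) (y i) := fun y =>
    Finset.prod_nonneg fun i _ => (hW _).1 _
  have hind : ∀ y : Fin n → Y, (if B (g y) = m then (0 : ℝ) else 1) ≤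
      hits A x S + hits A x (confusable S x y) := by
    intro y
    split_ifs with h
    · exact add_nonneg (hits_nonneg _ _ _) (hits_nonneg _ _ _)
    · have hne : g y ≠ x := fun he => h (by rw [he, hm])
      have hA : A x = A (g y) := by rw [hx, (hg y).1]
      by_cases hS : g y ∈ S
      · rw [hits_eq_one hS hA]
        linarith [hits_nonneg A x (confusable S x y)]
      · have : g y ∈ confusable S x y := by
          simp only [confusable, Finset.mem_filter, Finset.mem_univ, true_and]
          exact ⟨hne, hS, (hg y).2 x hx⟩
        rw [hits_eq_one this hA]
        linarith [hits_nonneg A x S]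
  calc _ ≤ ∑ y : Fin n → Y, ((∏ i, W (x i) (y i)) * hits A x S +
        (2 : ℝ) ^ (-(n : ℝ) * ε) * (outputWeight R x y * hits A x (confusable S x y))) := by
        refine Finset.sum_le_sum fun y _ => ?_
        refine (mul_le_mul_of_nonneg_left (hind y) (hW0 y)).trans ?_
        rw [mul_add, ← mul_assoc]
        gcongr
        · exact hits_nonneg _ _ _
        · exact prod_le_outputWeight hW (hε y)
    _ = _ := by
        rw [Finset.sum_add_distrib, ← Finset.sum_mul, sum_prod_channel hW, one_mul,
          Finset.mul_sum]

/-- The error probability, for any channel whose exponents on the initial segment `T` are at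
least `ε`, in terms of quantities that do not depend on the channel. -/
lemma codeError_le {μX : X → ℝ} {r : (Fin n → X) → ℕ} {T : Finset (Fin n → X)}
    (hT : ∀ x ∈ T, ∀ x' ∉ T, encoderKey μX r x < encoderKey μX r x')
    {W : X → Y → ℝ} (hW : IsChannel W) {R ε : ℝ}
    {A : (Fin n → X) → C} {B : (Fin n → X) → C'} {c : C} {I : Finset C'}
    (hI : Set.range B = (I : Set C'))
    {g : (Fin n → Y) → (Fin n → X)} (hg : IsMinEntropyDecoder A c g)
    (S : (Fin n → X) → Finset (Fin n → X))
    (hε : ∀ x ∈ T, ∀ y : Fin n → Y, (ε : EReal) ≤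
      condDivergence (condType y x) W (seqType x) +
        ((max (R - empCondEntropy x y) 0 : ℝ) : EReal)) :
    codeError W B (minDivEncoder μX r A B c) g ≤ 1 / (I.card : ℝ) *
      (((missed I B (fiberIn T A c)).card : ℝ) +
        ∑ x ∈ fiberIn T A c, (hits A x (S x) + (2 : ℝ) ^ (-(n : ℝ) * ε) *
          ∑ y : Fin n → Y, outputWeight R x y * hits A x (confusable (S x) x y))) := by
  classical
  set w : (Fin n → X) → ℝ := fun x => hits A x (S x) + (2 : ℝ) ^ (-(n : ℝ) * ε) *
    ∑ y : Fin n → Y, outputWeight R x y * hits A x (confusable (S x) x y) with hw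
  have hw0 : ∀ x, 0 ≤ w x := fun x => add_nonneg (hits_nonneg _ _ _) (mul_nonneg (by positivity)
    (Finset.sum_nonneg fun y _ => mul_nonneg (outputWeight_pos _ _ _).le (hits_nonneg _ _ _)))
  have hmem : ∀ x, B x ∈ I := fun x => by
    have : B x ∈ (I : Set C') := hI ▸ Set.mem_range_self x
    exact this
  have himg : Finset.univ.image B = I := by
    ext m
    have : m ∈ (I : Set C') ↔ ∃ x, B x = m := by rw [← hI]; rfl
    simpa using this.symm
  have hmsg : ∀ m, messageError W B (minDivEncoder μX r A B c) g m ≤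
      (if ∀ x ∈ T, ¬ (A x = c ∧ B x = m) then 1 else 0) +
        ∑ x ∈ fiberIn T A c, if B x = m then w x else 0 := by
    intro m
    by_cases h : ∃ x ∈ T, A x = c ∧ B x = m
    · obtain ⟨x, hxT, hA, hB, hsome⟩ := minDivEncoder_eq_some hT h
      have h1 : messageError W B (minDivEncoder μX r A B c) g m ≤ w x := by
        rw [messageError, hsome]
        exact sum_decoding_error_le hW hA hg hB (S x) (hε x hxT)
      refine h1.trans (le_trans ?_ (le_add_of_nonneg_left (by split_ifs <;> norm_num)))
      refine le_trans (le_of_eq (if_pos hB).symm) (Finset.single_le_sum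
        (f := fun x => if B x = m then w x else 0) (fun x' _ => ?_)
        (by simp [fiberIn, hxT, hA]))
      split_ifs
      exacts [hw0 _, le_rfl]
    · rw [if_pos (by push Not at h ⊢; exact h)]
      have h0 : 0 ≤ ∑ x ∈ fiberIn T A c, if B x = m then w x else 0 :=
        Finset.sum_nonneg fun x _ => by split_ifs; exacts [hw0 _, le_rfl]
      have h1 := messageError_le_one hW B (minDivEncoder μX r A B c) g m
      linarith
  unfold codeError
  rw [himg, hI, Set.ncard_coe_finset, ← Finset.mul_sum]
  refine mul_le_mul_of_nonneg_left ((Finset.sum_le_sum fun m _ => hmsg m).trans (le_of_eq ?_))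
    (by positivity)
  rw [Finset.sum_add_distrib, Finset.sum_comm (s := I)]
  congr 1
  · rw [missed, Finset.card_eq_sum_ones, Finset.sum_filter]
    push_cast
    refine Finset.sum_congr rfl fun m _ => ?_
    simp [fiberIn]
  · refine Finset.sum_congr rfl fun x _ => ?_
    rw [Finset.sum_ite_eq, if_pos (hmem x)]

lemma codeError_le_one {W : X → Y → ℝ} (hW : IsChannel W) (B : (Fin n → X) → C')
    (φ : C' → Option (Fin n → X)) (g : (Fin n → Y) → (Fin n → X)) :
    codeError W B φ g ≤ 1 := by
  classical
  have hc : ((Set.range B).ncard : ℝ) = ((Finset.univ.image B).card : ℝ) := by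
    rw [← Set.ncard_coe_finset]
    simp
  unfold codeError
  rw [hc, ← Finset.mul_sum]
  calc _ ≤ 1 / ((Finset.univ.image B).card : ℝ) * ∑ m ∈ Finset.univ.image B, 1 := by
        refine mul_le_mul_of_nonneg_left ?_ (by positivity)
        convert Finset.sum_le_sum fun m _ => messageError_le_one hW B φ g m
    _ ≤ 1 := by
        rw [Finset.sum_const, nsmul_eq_mul, mul_one]
        rw [one_div_mul_eq_div]
        exact div_self_le_one _

lemma codeError_nonneg {W : X → Y → ℝ} (hW : IsChannel W) (B : (Fin n → X) → C')
    (φ : C' → Option (Fin n → X)) (g : (Fin n → Y) → (Fin n → X)) :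
    0 ≤ codeError W B φ g := by
  unfold codeError
  refine Finset.sum_nonneg fun m _ => mul_nonneg (by positivity) ?_
  unfold messageError
  split
  · exact zero_le_one
  · refine Finset.sum_nonneg fun y _ => mul_nonneg
      (Finset.prod_nonneg fun i _ => (hW _).1 _) ?_
    split_ifs <;> norm_num

end Code

/-! ### Expected errors of a random code -/

section RandomCode

variable {X Y C C' : Type*} [Fintype X] [Fintype Y] [Fintype C] [Fintype C'] {n : ℕ}

open Classical in
/-- The sequences whose probability of collision with `x` is considerably larger than that of
uniformly distributed values. -/
def heavy (E : Ensemble (Fin n → X) C) (α : ℝ) (x : Fin n → X) : Finset (Fin n → X) :=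
  Finset.univ.filter fun x' => x' ≠ x ∧ 4 * max α 0 / (E.imF.card : ℝ) < E.collision x x'

lemma mem_heavy {E : Ensemble (Fin n → X) C} {α : ℝ} {x x' : Fin n → X} :
    x' ∈ heavy E α x ↔ x' ≠ x ∧ 4 * max α 0 / (E.imF.card : ℝ) < E.collision x x' := by
  simp [heavy]

/-- All the excess of collisions, in a total amount governed by `β`, is due to heavy
sequences. -/
lemma sum_collision_heavy_le [Nonempty X] (E : Ensemble (Fin n → X) C) {α β : ℝ}
    (x : Fin n → X)
    (h : ∑ x' ∈ heavy E α x, E.collision x x' ≤ ((heavy E α x).card : ℝ) * α / (E.imF.card : ℝ) +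
      min 1 ((heavy E α x).card : ℝ) * β) :
    ∑ x' ∈ heavy E α x, E.collision x x' ≤ 4 / 3 * max β 0 := by
  have hM : (0 : ℝ) < E.imF.card := by exact_mod_cast E.imF_card_pos
  have h1 : ((heavy E α x).card : ℝ) * (4 * max α 0 / (E.imF.card : ℝ)) ≤
      ∑ x' ∈ heavy E α x, E.collision x x' := by
    rw [← nsmul_eq_mul, ← Finset.sum_const]
    exact Finset.sum_le_sum fun x' hx' => by
      simp only [heavy, Finset.mem_filter] at hx'
      exact hx'.2.2.le
  have h2 : ((heavy E α x).card : ℝ) * α / (E.imF.card : ℝ) ≤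
      1 / 4 * (((heavy E α x).card : ℝ) * (4 * max α 0 / (E.imF.card : ℝ))) := by
    have : 1 / 4 * (((heavy E α x).card : ℝ) * (4 * max α 0 / (E.imF.card : ℝ))) =
        ((heavy E α x).card : ℝ) * max α 0 / (E.imF.card : ℝ) := by ring
    rw [this]
    gcongr
    exact le_max_left _ _
  have h3 : min 1 ((heavy E α x).card : ℝ) * β ≤ max β 0 := by
    have h4 : 0 ≤ min 1 ((heavy E α x).card : ℝ) := by positivity
    have h5 : min 1 ((heavy E α x).card : ℝ) ≤ 1 := min_le_left _ _
    calc _ ≤ min 1 ((heavy E α x).card : ℝ) * max β 0 := by gcongr; exact le_max_left _ _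
      _ ≤ 1 * max β 0 := by gcongr
      _ = _ := one_mul _
  linarith

/-- The loss, in the expected weight of the confusing output sequences, that is due to the number
of types and to the difference of the size of the image from `2^{nR}`. -/
def confusionFactor (X Y : Type*) [Fintype X] [Fintype Y] (n : ℕ) (R α M : ℝ) : ℝ :=
  ((n : ℝ) + 1) ^ (Fintype.card X * Fintype.card Y) *
    (1 + ((n : ℝ) + 1) ^ (Fintype.card X * Fintype.card Y) * (4 * max α 0) *
      (2 : ℝ) ^ ((n : ℝ) * R) / M)

lemma confusionFactor_pos (n : ℕ) (R α : ℝ) {M : ℝ} (hM : 0 < M) :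
    0 < confusionFactor X Y n R α M := by
  unfold confusionFactor; positivity

lemma sum_confusable_le [Nonempty X] (E : Ensemble (Fin n → X) C) (R α : ℝ) (x : Fin n → X) :
    ∑ A ∈ E.fns, E.prob A * ∑ y : Fin n → Y,
      outputWeight R x y * hits A x (confusable (heavy E α x) x y) ≤
        confusionFactor X Y n R α E.imF.card := by
  have hM : (0 : ℝ) < E.imF.card := by exact_mod_cast E.imF_card_pos
  set k := ((n : ℝ) + 1) ^ (Fintype.card X * Fintype.card Y) with hk
  set θ : ℝ := 4 * max α 0 / (E.imF.card : ℝ) with hθ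
  have hθ0 : 0 ≤ θ := by positivity
  have hone : ∀ y : Fin n → Y, outputWeight R x y *
      ∑ A ∈ E.fns, E.prob A * hits A x (confusable (heavy E α x) x y) ≤
        (1 + k * θ * (2 : ℝ) ^ ((n : ℝ) * R)) * (2 : ℝ) ^ (-(n : ℝ) * empCondEntropy y x) := by
    intro y
    rcases le_total R (empCondEntropy x y) with hR | hR
    · -- here the weight is at most `2^{-nH(y|x)}`
      calc _ ≤ outputWeight R x y * 1 := by
            gcongr
            · exact (outputWeight_pos _ _ _).le
            · exact E.sum_hits_le_one _ _
        _ = 1 * (2 : ℝ) ^ (-(n : ℝ) * empCondEntropy y x) := by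
            rw [outputWeight, max_eq_right (by linarith)]
            ring_nf
        _ ≤ _ := by
            gcongr
            have : 0 ≤ k * θ * (2 : ℝ) ^ ((n : ℝ) * R) := by positivity
            linarith
    · -- here the union bound over the confusable sequences is used
      have h1 : ∑ x' ∈ confusable (heavy E α x) x y, E.collision x x' ≤
          (k * (2 : ℝ) ^ ((n : ℝ) * empCondEntropy x y)) * θ := by
        calc _ ≤ ∑ x' ∈ confusable (heavy E α x) x y, θ := by
              refine Finset.sum_le_sum fun x' hx' => ?_
              have h := mem_confusable.1 hx'
              by_contra hlt
              exact h.2.1 (mem_heavy.2 ⟨h.1, not_le.1 hlt⟩)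
          _ = ((confusable (heavy E α x) x y).card : ℝ) * θ := by
              rw [Finset.sum_const, nsmul_eq_mul]
          _ ≤ _ := by
              refine mul_le_mul_of_nonneg_right ?_ hθ0
              refine le_trans ?_ (card_empCondEntropy_le y (empCondEntropy x y))
              norm_cast
              apply Finset.card_le_card
              intro x' hx'
              simp only [confusable, Finset.mem_filter, Finset.mem_univ, true_and] at hx' ⊢
              exact hx'.2.2
      calc _ ≤ outputWeight R x y * ((k * (2 : ℝ) ^ ((n : ℝ) * empCondEntropy x y)) * θ) := by
            gcongr
            · exact (outputWeight_pos _ _ _).le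
            · exact (E.sum_hits_le _ _).trans h1
        _ = k * θ * (2 : ℝ) ^ ((n : ℝ) * R) * (2 : ℝ) ^ (-(n : ℝ) * empCondEntropy y x) := by
            rw [outputWeight, max_eq_left (by linarith)]
            have : (n : ℝ) * (R - empCondEntropy x y - empCondEntropy y x) =
                n * R + -(n : ℝ) * empCondEntropy y x + -(n * empCondEntropy x y) := by ring
            rw [this, Real.rpow_add (by norm_num), Real.rpow_add (by norm_num),
              Real.rpow_neg (by norm_num) ((n : ℝ) * empCondEntropy x y)]
            field_simp
        _ ≤ _ := by
            gcongr
            linarith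
  calc _ = ∑ y : Fin n → Y, outputWeight R x y *
        ∑ A ∈ E.fns, E.prob A * hits A x (confusable (heavy E α x) x y) := by
        simp only [Finset.mul_sum]
        rw [Finset.sum_comm]
        exact Finset.sum_congr rfl fun y _ => Finset.sum_congr rfl fun A _ => by ring
    _ ≤ ∑ y : Fin n → Y, (1 + k * θ * (2 : ℝ) ^ ((n : ℝ) * R)) *
          (2 : ℝ) ^ (-(n : ℝ) * empCondEntropy y x) := Finset.sum_le_sum fun y _ => hone y
    _ ≤ (1 + k * θ * (2 : ℝ) ^ ((n : ℝ) * R)) * k := by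
        rw [← Finset.mul_sum]
        gcongr
        refine (sum_two_rpow_neg_empCondEntropy_le (X := Y) x).trans (le_of_eq ?_)
        rw [hk, mul_comm (Fintype.card Y)]
    _ = _ := by
        rw [confusionFactor, ← hk, hθ]
        ring

open Classical in
/-- A code of the ensemble whose channel-independent error quantities do not exceed their
means; the weight of the confusable sequences enters with an arbitrary factor `η`. -/
lemma exists_code [Nonempty X] (EA : Ensemble (Fin n → X) C) (EB : Ensemble (Fin n → X) C')
    (him : (EA.prod EB).im = EA.im ×ˢ EB.im) {αA βA αAB βAB : ℝ}
    (hA : ∀ T T' : Finset (Fin n → X), ∑ x ∈ T, ∑ x' ∈ T', EA.collision x x' ≤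
      ((T ∩ T').card : ℝ) + (T.card : ℝ) * (T'.card : ℝ) * αA / (EA.im.ncard : ℝ)
        + min (T.card : ℝ) (T'.card : ℝ) * βA)
    (hAB : ∀ T T' : Finset (Fin n → X), ∑ x ∈ T, ∑ x' ∈ T', (EA.prod EB).collision x x' ≤
      ((T ∩ T').card : ℝ) + (T.card : ℝ) * (T'.card : ℝ) * αAB / ((EA.prod EB).im.ncard : ℝ)
        + min (T.card : ℝ) (T'.card : ℝ) * βAB)
    {T : Finset (Fin n → X)} (hT : T.Nonempty) (R : ℝ) {η : ℝ} (hη : 0 ≤ η) :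
    ∃ A ∈ EA.fns, ∃ B ∈ EB.fns, ∃ c ∈ EA.imF,
      1 / (EB.imF.card : ℝ) *
        (((missed EB.imF B (fiberIn T A c)).card : ℝ) +
        ∑ x ∈ fiberIn T A c, (hits A x (heavy EA αA x) + η *
          ∑ y : Fin n → Y, outputWeight R x y * hits A x (confusable (heavy EA αA x) x y))) ≤
      αAB - 1 + (1 + βAB) * ((EA.prod EB).imF.card : ℝ) / T.card +
        (T.card : ℝ) / ((EA.prod EB).imF.card : ℝ) *
          (4 / 3 * max βA 0 + η * confusionFactor X Y n R αA EA.imF.card) := by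
  have h₁ := (EA.prod EB).sum_card_empty_fiber_le hT (α := αAB) (β := βAB) (by
    have := hAB T T
    rwa [Finset.inter_self, min_self, Ensemble.ncard_im] at this)
  have h₂ : ∀ x ∈ T, ∑ A ∈ EA.fns, EA.prob A * (hits A x (heavy EA αA x) + η *
      ∑ y : Fin n → Y, outputWeight R x y * hits A x (confusable (heavy EA αA x) x y)) ≤
        4 / 3 * max βA 0 + η * confusionFactor X Y n R αA EA.imF.card := by
    intro x _
    simp only [mul_add, Finset.sum_add_distrib]
    refine add_le_add ((EA.sum_hits_le _ _).trans (sum_collision_heavy_le EA x ?_)) ?_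
    · have := hA {x} (heavy EA αA x)
      rw [Finset.sum_singleton, Finset.singleton_inter_of_notMem (by simp [mem_heavy]),
        Finset.card_singleton, Ensemble.ncard_im] at this
      simpa using this
    · simp only [mul_left_comm _ η]
      rw [← Finset.mul_sum]
      exact mul_le_mul_of_nonneg_left (sum_confusable_le EA R αA x) hη
  exact Ensemble.exists_choice EA EB him T
    (fun A x => hits A x (heavy EA αA x) + η *
      ∑ y : Fin n → Y, outputWeight R x y * hits A x (confusable (heavy EA αA x) x y)) h₁ h₂

end RandomCode

/-! ### Subexponential growth -/

section Subexponential

/-- Multiplication by a negative exponential makes the sequence tend to zero. -/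
def Subexponential (f : ℕ → ℝ) : Prop :=
  ∀ ε : ℝ, 0 < ε → Tendsto (fun n : ℕ => f n * (2 : ℝ) ^ (-(n : ℝ) * ε)) atTop (𝓝 0)

lemma Subexponential.mul {f g : ℕ → ℝ} (hf : Subexponential f) (hg : Subexponential g) :
    Subexponential (fun n => f n * g n) := by
  intro ε hε
  have := (hf _ (half_pos hε)).mul (hg _ (half_pos hε))
  rw [mul_zero] at this
  refine this.congr fun n => ?_
  rw [mul_mul_mul_comm, ← Real.rpow_add (by norm_num)]
  ring_nf

lemma Subexponential.add {f g : ℕ → ℝ} (hf : Subexponential f) (hg : Subexponential g) :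
    Subexponential (fun n => f n + g n) := by
  intro ε hε
  have := (hf ε hε).add (hg ε hε)
  rw [add_zero] at this
  exact this.congr fun n => by ring

lemma subexponential_poly (k : ℕ) : Subexponential (fun n : ℕ => ((n : ℝ) + 1) ^ k) :=
  fun _ hε => tendsto_poly_mul_two_rpow k hε

lemma subexponential_of_tendsto {f : ℕ → ℝ} {a : ℝ} (hf : Tendsto f atTop (𝓝 a)) :
    Subexponential f := by
  intro ε hε
  have h := tendsto_poly_mul_two_rpow 0 hε
  simp only [pow_zero, one_mul] at h
  simpa using hf.mul h

lemma subexponential_const (a : ℝ) : Subexponential (fun _ => a) :=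
  subexponential_of_tendsto tendsto_const_nhds

lemma subexponential_of_logb {f : ℕ → ℝ} (hf : ∀ᶠ n in atTop, 0 < f n)
    (h : Tendsto (fun n : ℕ => Real.logb 2 (f n) / n) atTop (𝓝 0)) : Subexponential f := by
  intro ε hε
  have h0 := tendsto_poly_mul_two_rpow 0 (half_pos hε)
  simp only [pow_zero, one_mul] at h0
  refine tendsto_of_tendsto_of_tendsto_of_le_of_le' tendsto_const_nhds h0 ?_ ?_
  · filter_upwards [hf] with n hn
    positivity
  · filter_upwards [hf, h.eventually_lt_const (half_pos hε), eventually_gt_atTop 0]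
      with n hn hlt hn0
    have hn' : (0 : ℝ) < n := by exact_mod_cast hn0
    rw [div_lt_iff₀ hn'] at hlt
    conv_lhs => rw [← Real.rpow_logb (by norm_num : (0 : ℝ) < 2) (by norm_num) hn]
    rw [← Real.rpow_add (by norm_num)]
    apply Real.rpow_le_rpow_of_exponent_le (by norm_num)
    linarith

lemma tendsto_logb_two_rpow_div {M : ℕ → ℝ} (hM : ∀ n, 0 < M n) {R : ℝ}
    (h : Tendsto (fun n : ℕ => Real.logb 2 (M n) / n) atTop (𝓝 R)) :
    Tendsto (fun n : ℕ => Real.logb 2 ((2 : ℝ) ^ ((n : ℝ) * R) / M n) / n) atTop (𝓝 0) := by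
  have h1 := (tendsto_const_nhds (x := R)).sub h
  rw [sub_self] at h1
  refine h1.congr' ?_
  filter_upwards [eventually_gt_atTop 0] with n hn
  have hn' : (n : ℝ) ≠ 0 := by positivity
  rw [Real.logb_div (by positivity) (hM n).ne', Real.logb_rpow (by norm_num) (by norm_num)]
  field_simp

lemma subexponential_two_rpow_div {M : ℕ → ℝ} (hM : ∀ n, 0 < M n) {R : ℝ}
    (h : Tendsto (fun n : ℕ => Real.logb 2 (M n) / n) atTop (𝓝 R)) :
    Subexponential (fun n : ℕ => (2 : ℝ) ^ ((n : ℝ) * R) / M n) :=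
  subexponential_of_logb (Eventually.of_forall fun n => div_pos (by positivity) (hM n))
    (tendsto_logb_two_rpow_div hM h)

lemma subexponential_div_two_rpow {M : ℕ → ℝ} (hM : ∀ n, 0 < M n) {R : ℝ}
    (h : Tendsto (fun n : ℕ => Real.logb 2 (M n) / n) atTop (𝓝 R)) :
    Subexponential (fun n : ℕ => M n / (2 : ℝ) ^ ((n : ℝ) * R)) := by
  refine subexponential_of_logb (Eventually.of_forall fun n => div_pos (hM n) (by positivity)) ?_
  have := (tendsto_logb_two_rpow_div hM h).neg
  rw [neg_zero] at this
  refine this.congr fun n => ?_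
  rw [← neg_div, ← Real.logb_inv, inv_div]

end Subexponential

/-! ### A sequence of codes that is good for all channels -/

section Codes

open Classical in
lemma divergence_le_of_mem_initialSegment {X : Type*} [Fintype X] {n : ℕ} {μX : X → ℝ}
    {r : (Fin n → X) → ℕ} {T : Finset (Fin n → X)}
    (hT : ∀ x ∈ T, ∀ x' ∉ T, encoderKey μX r x < encoderKey μX r x') {γ : EReal}
    (hcard : T.card ≤ (Finset.univ.filter fun x : Fin n → X =>
      divergence (seqType x) μX ≤ γ).card) {x : Fin n → X} (hx : x ∈ T) :
    divergence (seqType x) μX ≤ γ := by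
  by_contra h
  push Not at h
  have hsub : (Finset.univ.filter fun x : Fin n → X => divergence (seqType x) μX ≤ γ) ⊆
      T.erase x := by
    intro x' hx'
    have hx' := (Finset.mem_filter.1 hx').2
    have hlt : divergence (seqType x') μX < divergence (seqType x) μX := hx'.trans_lt h
    refine Finset.mem_erase.2 ⟨fun he => by rw [he] at hlt; exact lt_irrefl _ hlt, ?_⟩
    by_contra hmem
    exact lt_asymm (hT x hx x' hmem) (lt_of_not_ge fun hle => by
      rcases encoderKey_le_iff.1 hle with h1 | h1
      · exact lt_asymm h1 hlt
      · exact hlt.ne h1.1.symm)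
  have h1 := Finset.card_le_card hsub
  rw [Finset.card_erase_of_mem hx] at h1
  have h2 := Finset.card_pos.2 ⟨x, hx⟩
  omega

variable {X : Type*} (Y : Type*) [Fintype X] [Fintype Y]
  {CA CB : ℕ → Type*} [∀ n, Fintype (CA n)] [∀ n, Fintype (CB n)]

/-- One sequence of codes has, for all channels of equivocation less than `RA - δ` at once, an
error probability that is bounded by the part of the error bound without an exponent. The
exponential term is absorbed by the `κ`-dependent ones: the number of candidates for code
words is chosen as about `5/4` times `κ |Im A| |Im B|`, which leaves a margin of order
`1/κ`, and `κ` grows less than exponentially. -/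
theorem exists_universal_codes [Nonempty X]
    (EA : ∀ n, Ensemble (Fin n → X) (CA n)) (EB : ∀ n, Ensemble (Fin n → X) (CB n))
    {αA βA αAB βAB : ℕ → ℝ} (hA : HashProperty EA αA βA)
    (hAB : HashProperty (fun n => (EA n).prod (EB n)) αAB βAB)
    (him : ∀ n, 1 ≤ n → ((EA n).prod (EB n)).im = (EA n).im ×ˢ (EB n).im)
    {RA RB : ℝ} (hRA : 0 < RA)
    (hrateA : Tendsto (fun n : ℕ => Real.logb 2 ((EA n).im.ncard : ℝ) / n) atTop (𝓝 RA))
    (hrateB : Tendsto (fun n : ℕ => Real.logb 2 ((EB n).im.ncard : ℝ) / n) atTop (𝓝 RB))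
    {μX : X → ℝ} (hμX : IsPMF μX) (hH : RA + RB < entropy μX)
    {κ : ℕ → ℝ} (hκ : Tendsto κ atTop atTop)
    (hκlog : Tendsto (fun n : ℕ => Real.logb 2 (κ n) / n) atTop (𝓝 0))
    (r : ∀ n, (Fin n → X) → ℕ) (hr : ∀ n, Function.Injective (r n)) :
    ∃ (A : ∀ n, (Fin n → X) → CA n) (B : ∀ n, (Fin n → X) → CB n) (c : ∀ n, CA n),
      (∀ n, A n ∈ (EA n).fns ∧ B n ∈ (EB n).fns ∧ c n ∈ Set.range (A n)) ∧
      ∀ δ : ℝ, 0 < δ → ∀ᶠ n : ℕ in atTop,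
        ∀ g : (Fin n → Y) → (Fin n → X), IsMinEntropyDecoder (A n) (c n) g →
        ∀ W ∈ channelClass Y μX (RA - δ),
          codeError W (B n) (minDivEncoder μX (r n) (A n) (B n) (c n)) g ≤
            αAB n - 1 + (βAB n + 1) / κ n + 2 * κ n * βA n := by
  classical
  simp only [Ensemble.ncard_im] at hrateA hrateB
  set MA : ℕ → ℝ := fun n => ((EA n).imF.card : ℝ) with hMA
  set MB : ℕ → ℝ := fun n => ((EB n).imF.card : ℝ) with hMB
  set M : ℕ → ℝ := fun n => (((EA n).prod (EB n)).imF.card : ℝ) with hM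
  have hMA0 : ∀ n, 0 < MA n := fun n => by
    simp only [hMA]; exact_mod_cast (EA n).imF_card_pos
  have hMB0 : ∀ n, 0 < MB n := fun n => by
    simp only [hMB]; exact_mod_cast (EB n).imF_card_pos
  have hM0 : ∀ n, 0 < M n := fun n => by
    simp only [hM]; exact_mod_cast ((EA n).prod (EB n)).imF_card_pos
  have hMM : ∀ n, 1 ≤ n → M n = MA n * MB n := fun n hn => by
    simp only [hM, hMA, hMB]
    rw [Ensemble.imF_prod _ _ (him n hn), Finset.card_product]
    push_cast
    rfl
  -- growth rates
  have hsκ : Subexponential κ := subexponential_of_logb (hκ.eventually_gt_atTop 0) hκlog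
  have hsA := subexponential_two_rpow_div hMA0 hrateA
  have hsα : Subexponential (fun n => max (αA n) 0) :=
    subexponential_of_tendsto (hA.alpha_lim.max tendsto_const_nhds)
  have hsconf : Subexponential (fun n => confusionFactor X Y n RA (αA n) (MA n)) := by
    have := (subexponential_poly (Fintype.card X * Fintype.card Y)).mul
      ((subexponential_const 1).add (((subexponential_poly (Fintype.card X * Fintype.card Y)).mul
        ((subexponential_const 4).mul hsα)).mul hsA))
    refine (congrArg Subexponential (funext fun n => ?_)).mp this
    simp only [confusionFactor]
    ring
  set η : ℕ → ℝ := fun n => 1 / (30 * κ n ^ 2 * confusionFactor X Y n RA (αA n) (MA n)) with hη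
  set t : ℕ → ℕ := fun n => ⌈5 / 4 * (κ n * M n)⌉₊ with ht
  have ht1 : ∀ n, 5 / 4 * (κ n * M n) ≤ t n := fun n => Nat.le_ceil _
  have ht2 : ∀ n, 4 ≤ κ n → (t n : ℝ) ≤ 3 / 2 * (κ n * M n) := by
    intro n hn
    have h1 : (1 : ℝ) ≤ M n := by simp only [hM]; exact_mod_cast ((EA n).prod (EB n)).imF_card_pos
    have h2 : 4 ≤ κ n * M n := by nlinarith
    have h3 := Nat.ceil_lt_add_one (show 0 ≤ 5 / 4 * (κ n * M n) by linarith)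
    simp only [ht]
    linarith
  -- the number `t n` of candidates is eventually less than that of the sequences near `μX`
  obtain ⟨s, hs0, hs⟩ : ∃ s, 0 < s ∧ RA + RB + s = entropy μX - s :=
    ⟨(entropy μX - RA - RB) / 2, by linarith, by ring⟩
  have htle : ∀ᶠ n : ℕ in atTop, (t n : ℝ) ≤ (2 : ℝ) ^ ((n : ℝ) * (entropy μX - s)) := by
    have hsub := ((subexponential_const (3 / 2)).mul hsκ).mul
      ((subexponential_div_two_rpow hMA0 hrateA).mul (subexponential_div_two_rpow hMB0 hrateB))
    filter_upwards [(hsub s hs0).eventually_lt_const zero_lt_one, hκ.eventually_ge_atTop 4,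
      eventually_ge_atTop 1] with n h1 h2 h3
    refine (ht2 n h2).trans ?_
    rw [← hs, hMM n h3, mul_add, mul_add, Real.rpow_add (by norm_num),
      Real.rpow_add (by norm_num)]
    rw [neg_mul, Real.rpow_neg (by norm_num)] at h1
    have e1 : (0 : ℝ) < 2 ^ ((n : ℝ) * RA) := by positivity
    have e2 : (0 : ℝ) < 2 ^ ((n : ℝ) * RB) := by positivity
    have e3 : (0 : ℝ) < 2 ^ ((n : ℝ) * s) := by positivity
    have e4 : 3 / 2 * κ n * (MA n / 2 ^ ((n : ℝ) * RA) * (MB n / 2 ^ ((n : ℝ) * RB))) *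
        (2 ^ ((n : ℝ) * s))⁻¹ = 3 / 2 * (κ n * (MA n * MB n)) /
          (2 ^ ((n : ℝ) * RA) * 2 ^ ((n : ℝ) * RB) * 2 ^ ((n : ℝ) * s)) := by
      field_simp
    rw [e4, div_lt_one (by positivity)] at h1
    exact h1.le
  have hfew : ∀ γ : ℝ, 0 < γ → ∀ᶠ n : ℕ in atTop, t n ≤
      (Finset.univ.filter fun x : Fin n → X => divergence (seqType x) μX ≤ (γ : EReal)).card := by
    intro γ hγ
    filter_upwards [htle, eventually_le_card_divergence_le hμX hγ hs0] with n h1 h2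
    exact_mod_cast h1.trans h2
  -- the codes
  have hcode : ∀ n, ∃ (A : (Fin n → X) → CA n) (B : (Fin n → X) → CB n) (c : CA n),
      (A ∈ (EA n).fns ∧ B ∈ (EB n).fns ∧ c ∈ Set.range A) ∧
      (1 ≤ n → 4 ≤ κ n → t n ≤ Fintype.card (Fin n → X) → ∃ T : Finset (Fin n → X),
        T.card = t n ∧ (∀ x ∈ T, ∀ x' ∉ T, encoderKey μX (r n) x < encoderKey μX (r n) x') ∧
        1 / MB n * (((missed (EB n).imF B (fiberIn T A c)).card : ℝ) +
          ∑ x ∈ fiberIn T A c, (hits A x (heavy (EA n) (αA n) x) + η n *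
            ∑ y : Fin n → Y, outputWeight RA x y *
              hits A x (confusable (heavy (EA n) (αA n) x) x y))) ≤
        αAB n - 1 + (1 + βAB n) * M n / t n + (t n : ℝ) / M n *
          (4 / 3 * max (βA n) 0 + η n * confusionFactor X Y n RA (αA n) (MA n))) := by
    intro n
    by_cases hgood : 1 ≤ n ∧ 4 ≤ κ n ∧ t n ≤ Fintype.card (Fin n → X)
    · obtain ⟨hn, hκn, htn⟩ := hgood
      obtain ⟨T, hTc, hT⟩ := exists_initialSegment (encoderKey μX (r n))
        (encoderKey_injective μX (hr n)) (t n) htn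
      have htpos : 0 < t n := by
        have h1 := hM0 n
        have h2 := ht1 n
        have h3 : 0 < 5 / 4 * (κ n * M n) := by positivity
        exact_mod_cast h3.trans_le h2
      obtain ⟨A, hAm, B, hBm, c, hc, hle⟩ := exists_code (Y := Y) (EA n) (EB n) (him n hn)
        (hA.collision_le n hn) (hAB.collision_le n hn)
        (T := T) (Finset.card_pos.1 (hTc ▸ htpos)) RA (η := η n)
        (by
          have := confusionFactor_pos (X := X) (Y := Y) n RA (αA n) (hMA0 n)
          simp only [hη]
          positivity)
      refine ⟨A, B, c, ⟨hAm, hBm, ?_⟩, fun _ _ _ => ⟨T, hTc, hT, ?_⟩⟩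
      · rw [hA.range_eq n hn A hAm]
        exact (EA n).mem_imF.1 hc
      · rw [hTc] at hle
        exact hle
    · obtain ⟨A, hAm⟩ := (EA n).fns_nonempty
      obtain ⟨B, hBm⟩ := (EB n).fns_nonempty
      exact ⟨A, B, A (Classical.arbitrary _), ⟨hAm, hBm, _, rfl⟩,
        fun h1 h2 h3 => absurd ⟨h1, h2, h3⟩ hgood⟩
  choose A B c hmem hprop using hcode
  refine ⟨A, B, c, hmem, fun δ hδ => ?_⟩
  obtain ⟨ε, hε, γ, hγ, hexp⟩ := exists_exponent_lower_bound (Y := Y) hμX RA hδ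
  -- the exponential is eventually below the weight `η`
  have hηle := (((subexponential_const 30).mul (hsκ.mul hsκ)).mul hsconf ε hε).eventually_lt_const
    zero_lt_one
  -- `β` is at least minus something exponentially small
  have hβsmall := ((((subexponential_const 40).mul (hsκ.mul hsκ)).mul
    (hsα.mul hsA)) RA hRA).eventually_lt_const zero_lt_one
  filter_upwards [hfew γ hγ, hηle, hβsmall, hκ.eventually_ge_atTop 4, eventually_ge_atTop 1,
    hAB.beta_lim.eventually_const_lt (show (-1 / 2 : ℝ) < 0 by norm_num)]
    with n hfew hηle hβsmall hκ4 hn hβAB g hg W hW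
  have hκ0 : 0 < κ n := by linarith
  have hconf := confusionFactor_pos (X := X) (Y := Y) n RA (αA n) (hMA0 n)
  obtain ⟨T, hTc, hT, hle⟩ := hprop n hn hκ4 (hfew.trans (Finset.card_le_univ _))
  have hTγ : ∀ x ∈ T, divergence (seqType x) μX ≤ (γ : EReal) := fun x hx =>
    divergence_le_of_mem_initialSegment hT (hTc ▸ hfew) hx
  have hrange : Set.range (B n) = ((EB n).imF : Set (CB n)) := by
    rw [(EA n).range_snd (EB n) (him n hn) (hAB.range_eq n hn) (hmem n).2.1]
    ext m
    simp [Ensemble.mem_imF]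
  have herr := codeError_le hT hW.1 hrange hg (heavy (EA n) (αA n))
    (fun x hx y => hexp n (by omega) x y W hW.1 (hTγ x hx) hW.2)
  refine herr.trans (le_trans ?_ (hle.trans ?_))
  · have : (2 : ℝ) ^ (-(n : ℝ) * ε) ≤ η n := by
      simp only [hη]
      rw [le_div_iff₀ (by positivity)]
      calc _ = 30 * (κ n * κ n) * confusionFactor X Y n RA (αA n) (MA n) *
            2 ^ (-(n : ℝ) * ε) := by ring
        _ ≤ 1 := hηle.le
    simp only [hMB]
    gcongr with x hx
    exact Finset.sum_nonneg fun y _ => mul_nonneg (outputWeight_pos _ _ _).le (hits_nonneg _ _ _)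
  · have ht0 : (0 : ℝ) < t n := lt_of_lt_of_le (by have := hM0 n; positivity) (ht1 n)
    have h1 : (1 + βAB n) * M n / t n ≤ 4 / 5 * ((1 + βAB n) / κ n) := by
      rw [div_le_iff₀ ht0]
      have : 4 / 5 * ((1 + βAB n) / κ n) * (5 / 4 * (κ n * M n)) = (1 + βAB n) * M n := by
        field_simp
      rw [← this]
      refine mul_le_mul_of_nonneg_left (ht1 n) ?_
      have : 0 ≤ 1 + βAB n := by linarith
      positivity
    have h2 : (t n : ℝ) / M n ≤ 3 / 2 * κ n := by
      rw [div_le_iff₀ (hM0 n)]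
      linarith [ht2 n hκ4]
    have h3 : (t n : ℝ) / M n *
        (4 / 3 * max (βA n) 0 + η n * confusionFactor X Y n RA (αA n) (MA n)) ≤
        2 * κ n * max (βA n) 0 + 1 / (20 * κ n) := by
      have h4 : η n * confusionFactor X Y n RA (αA n) (MA n) = 1 / (30 * κ n ^ 2) := by
        simp only [hη]
        field_simp
      rw [h4]
      calc _ ≤ 3 / 2 * κ n * (4 / 3 * max (βA n) 0 + 1 / (30 * κ n ^ 2)) := by gcongr
        _ = _ := by
          field_simp
          ring
    have h5 : max (βA n) 0 - βA n ≤ max (αA n) 0 / MA n := by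
      obtain ⟨x⟩ : Nonempty (Fin n → X) := inferInstance
      have h6 := hA.collision_le n hn {x} {x}
      simp only [Finset.sum_singleton, Ensemble.collision_self, Finset.inter_self,
        Finset.card_singleton, Nat.cast_one, one_mul, min_self, Ensemble.ncard_im] at h6
      have h7 : αA n / MA n ≤ max (αA n) 0 / MA n := by
        have := (hMA0 n).le
        gcongr
        exact le_max_left _ _
      have h8 : 0 ≤ max (αA n) 0 / MA n := by
        have := (hMA0 n).le
        positivity
      have h9 : αA n / ((EA n).imF.card : ℝ) = αA n / MA n := rfl
      rcases max_cases (βA n) 0 with ⟨h, _⟩ | ⟨h, _⟩ <;> rw [h] <;> linarith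
    have h6 : 40 * κ n ^ 2 * (max (αA n) 0 / MA n) ≤ 1 := by
      have e : 40 * (κ n * κ n) * (max (αA n) 0 * (2 ^ ((n : ℝ) * RA) / MA n)) *
          2 ^ (-(n : ℝ) * RA) = 40 * κ n ^ 2 * (max (αA n) 0 / MA n) := by
        have := (hMA0 n).ne'
        rw [neg_mul, Real.rpow_neg (by norm_num)]
        field_simp
      rw [← e]
      exact hβsmall.le
    have h7 : 2 * κ n * (max (βA n) 0 - βA n) ≤ 1 / (20 * κ n) := by
      rw [le_div_iff₀ (by positivity)]
      calc _ = 40 * κ n ^ 2 * (max (βA n) 0 - βA n) := by ring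
        _ ≤ 40 * κ n ^ 2 * (max (αA n) 0 / MA n) := by gcongr
        _ ≤ 1 := h6
    have h8 : 1 / (20 * κ n) + 1 / (20 * κ n) ≤ 1 / 5 * ((1 + βAB n) / κ n) := by
      have : 1 / (20 * κ n) + 1 / (20 * κ n) = 1 / 5 * ((1 / 2) / κ n) := by
        field_simp
        ring
      rw [this]
      gcongr
      linarith
    have h9 : (βAB n + 1) / κ n = (1 + βAB n) / κ n := by rw [add_comm]
    rw [h9]
    linarith

end Codes

/-! ### Rounding distributions to types -/

section Rounding

lemma exists_counts {Z : Type*} [Fintype Z] {p : Z → ℝ} (hp : IsPMF p) (m : ℕ) :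
    ∃ k : Z → ℕ, ∑ b, k b = m ∧ ∀ b, |(k b : ℝ) - m * p b| ≤ Fintype.card Z ∧
      (p b = 0 → k b = 0) := by
  classical
  have hnn : ∀ b, 0 ≤ (m : ℝ) * p b := fun b => mul_nonneg (Nat.cast_nonneg m) (hp.1 b)
  obtain ⟨b₀, hb₀⟩ : ∃ b, p b ≠ 0 := by
    by_contra! h
    have := hp.2
    simp [h] at this
  set f : Z → ℕ := fun b => ⌊(m : ℝ) * p b⌋₊ with hf
  have hf1 : ∀ b, (f b : ℝ) ≤ m * p b := fun b => Nat.floor_le (hnn b)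
  have hf2 : ∀ b, (m : ℝ) * p b < f b + 1 := fun b => Nat.lt_floor_add_one _
  have hsum : ∑ b, (m : ℝ) * p b = m := by rw [← Finset.mul_sum, hp.2, mul_one]
  have hle : ∑ b, f b ≤ m := by
    have : ∑ b, (f b : ℝ) ≤ m := (Finset.sum_le_sum fun b _ => hf1 b).trans hsum.le
    exact_mod_cast this
  have hres : ((m - ∑ b, f b : ℕ) : ℝ) ≤ Fintype.card Z := by
    rw [Nat.cast_sub hle, sub_le_iff_le_add]
    push_cast
    calc (m : ℝ) = ∑ b, (m : ℝ) * p b := hsum.symm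
      _ ≤ ∑ b, (1 + (f b : ℝ)) := Finset.sum_le_sum fun b _ => by linarith [hf2 b]
      _ = _ := by rw [Finset.sum_add_distrib]; simp
  have hcard : (1 : ℝ) ≤ Fintype.card Z := by
    exact_mod_cast Fintype.card_pos_iff.2 ⟨b₀⟩
  refine ⟨fun b => f b + if b = b₀ then m - ∑ b, f b else 0, ?_, fun b => ⟨?_, fun hb => ?_⟩⟩
  · rw [Finset.sum_add_distrib, Finset.sum_ite_eq', if_pos (Finset.mem_univ _)]
    omega
  · rw [abs_le]
    beta_reduce
    have h1 := hf1 b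
    have h2 := hf2 b
    split_ifs
    · rw [Nat.cast_add]
      have h3 : (0 : ℝ) ≤ ((m - ∑ b, f b : ℕ) : ℝ) := Nat.cast_nonneg _
      constructor <;> linarith
    · rw [add_zero]
      constructor <;> linarith
  · have hne : b ≠ b₀ := fun h => hb₀ (h ▸ hb)
    simp [hf, hb, hne]

open Classical in
lemma exists_function_of_counts {S Z : Type*} [Fintype S] [Fintype Z] {k : Z → ℕ}
    (hk : ∑ b, k b = Fintype.card S) :
    ∃ z : S → Z, ∀ b, (Finset.univ.filter fun i => z i = b).card = k b := by
  have e : S ≃ Σ b, Fin (k b) := Fintype.equivOfCardEq (by simp [hk])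
  refine ⟨fun i => (e i).1, fun b => ?_⟩
  rw [← Fintype.card_subtype, Fintype.card_congr
    (e.subtypeEquiv (q := fun s : Σ b, Fin (k b) => s.1 = b) fun i => Iff.rfl)]
  rw [Fintype.card_congr (Equiv.sigmaSubtype (β := fun b => Fin (k b)) b)]
  simp

open Classical in
/-- A distribution is approximated, up to a constant number of positions for each letter, by a
function on any finite set of positions. -/
lemma exists_rounding (S : Type*) {Z : Type*} [Fintype S] [Fintype Z] {p : Z → ℝ} (hp : IsPMF p) :
    ∃ z : S → Z, ∀ b, |((Finset.univ.filter fun i => z i = b).card : ℝ) - Fintype.card S * p b| ≤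
      Fintype.card Z ∧ (p b = 0 → (Finset.univ.filter fun i => z i = b).card = 0) := by
  obtain ⟨k, hk, h⟩ := exists_counts hp (Fintype.card S)
  obtain ⟨z, hz⟩ := exists_function_of_counts hk
  exact ⟨z, fun b => by simpa only [hz] using h b⟩

lemma exists_pos_lower_bound {Z : Type*} [Finite Z] (p : Z → ℝ) (hp : ∀ a, 0 ≤ p a) :
    ∃ w : ℝ, 0 < w ∧ ∀ a, p a ≠ 0 → w ≤ p a := by
  cases nonempty_fintype Z
  by_cases h : (Finset.univ.filter fun a => 0 < p a).Nonempty
  · obtain ⟨a₀, ha₀, hmin⟩ := Finset.exists_min_image _ p h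
    exact ⟨p a₀, (Finset.mem_filter.1 ha₀).2, fun a ha =>
      hmin a (Finset.mem_filter.2 ⟨Finset.mem_univ _, lt_of_le_of_ne (hp a) ha.symm⟩)⟩
  · refine ⟨1, one_pos, fun a ha => absurd ⟨a, ?_⟩ h⟩
    exact Finset.mem_filter.2 ⟨Finset.mem_univ _, lt_of_le_of_ne (hp a) ha.symm⟩

/-- The divergence is at most quadratic in the difference of the distributions. -/
lemma divergence_le_sum_sq {Z : Type*} [Fintype Z] {p q : Z → ℝ} (hp : IsPMF p) (hq : IsPMF q)
    (hac : ∀ a, q a = 0 → p a = 0) {w : ℝ} (hw : 0 < w) (hwq : ∀ a, q a ≠ 0 → w ≤ q a) :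
    divergence p q ≤ ((2 * ∑ a, (p a - q a) ^ 2 / w : ℝ) : EReal) := by
  rw [divergence, if_pos hac, EReal.coe_le_coe_iff]
  have h1 : ∑ a, p a * Real.log (p a / q a) ≤ ∑ a, (p a - q a) ^ 2 / w := by
    have h2 : ∀ a, p a * Real.log (p a / q a) ≤ (p a - q a) ^ 2 / w + (p a - q a) := by
      intro a
      by_cases ha : p a = 0
      · have : 0 ≤ (p a - q a) ^ 2 / w - q a := by
          by_cases hqa : q a = 0
          · simp [ha, hqa]
          · rw [ha, zero_sub, neg_sq, sub_nonneg, le_div_iff₀ hw]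
            nlinarith [hwq a hqa, hq.1 a]
        rw [ha] at this ⊢
        simp only [zero_mul]
        linarith
      · have hqa : q a ≠ 0 := fun h => ha (hac a h)
        have hp0 : 0 < p a := lt_of_le_of_ne (hp.1 a) (Ne.symm ha)
        have hq0 : 0 < q a := lt_of_le_of_ne (hq.1 a) (Ne.symm hqa)
        calc p a * Real.log (p a / q a) ≤ p a * (p a / q a - 1) := by
              gcongr
              exact Real.log_le_sub_one_of_pos (div_pos hp0 hq0)
          _ = (p a - q a) ^ 2 / q a + (p a - q a) := by
              field_simp
              ring
          _ ≤ _ := by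
              gcongr
              exact hwq a hqa
    refine (Finset.sum_le_sum fun a _ => h2 a).trans (le_of_eq ?_)
    rw [Finset.sum_add_distrib, Finset.sum_sub_distrib, hp.2, hq.2]
    ring
  have h0 : 0 ≤ ∑ a, (p a - q a) ^ 2 / w := Finset.sum_nonneg fun a _ => by positivity
  have h3 : ∑ a, p a * Real.logb 2 (p a / q a) =
      (∑ a, p a * Real.log (p a / q a)) / Real.log 2 := by
    rw [Finset.sum_div]
    exact Finset.sum_congr rfl fun a _ => by rw [Real.logb, mul_div_assoc]
  rw [h3, div_le_iff₀ (Real.log_pos (by norm_num))]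
  nlinarith [Real.log_two_gt_d9]

/-- The types nearest to `μX` differ from it by `O(1/n)`. -/
lemma exists_nearestType_close {X : Type*} [Fintype X] {μX : X → ℝ} (hμ : IsPMF μX) :
    ∃ C : ℝ, ∀ n : ℕ, n ≠ 0 → ∀ U : X → ℝ, IsNearestType μX n U →
      ∀ a, |U a - μX a| ≤ C / n ∧ (μX a = 0 → U a = 0) := by
  classical
  obtain ⟨w, hw, hwμ⟩ := exists_pos_lower_bound μX hμ.1
  set k : ℝ := (Fintype.card X : ℝ) with hk
  refine ⟨2 * √(2 * k ^ 3 / w), fun n hn U hU => ?_⟩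
  have hn' : (0 : ℝ) < n := by positivity
  obtain ⟨x, hx⟩ := exists_rounding (Fin n) hμ
  have hx1 : ∀ a, |seqType x a - μX a| ≤ k / n := by
    intro a
    have h := (hx a).1
    rw [Fintype.card_fin] at h
    have e : seqType x a - μX a =
        (((Finset.univ.filter fun i => x i = a).card : ℝ) - n * μX a) / n := by
      rw [seqType, sub_div, mul_div_cancel_left₀ _ hn'.ne']
    rw [e, abs_div, abs_of_pos hn']
    gcongr
  have hx2 : ∀ a, μX a = 0 → seqType x a = 0 := by
    intro a ha
    by_contra h
    obtain ⟨i, hi⟩ := exists_of_seqType_ne_zero h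
    have := (hx a).2 ha
    rw [Finset.card_eq_zero, Finset.filter_eq_empty_iff] at this
    exact this (Finset.mem_univ i) hi
  obtain ⟨⟨xU, rfl⟩, hmin⟩ := hU
  have hD : divergence (seqType xU) μX ≤ (((√(2 * k ^ 3 / w) / n) ^ 2 : ℝ) : EReal) := by
    refine (hmin x).trans ((divergence_le_sum_sq (isPMF_seqType hn x) hμ hx2 hw hwμ).trans ?_)
    rw [EReal.coe_le_coe_iff, div_pow, Real.sq_sqrt (by positivity)]
    calc 2 * ∑ a, (seqType x a - μX a) ^ 2 / w ≤ 2 * ∑ a : X, (k / n) ^ 2 / w := by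
          gcongr 2 * ∑ a, ?_ / w with a
          exact sq_le_sq' (abs_le.1 (hx1 a)).1 (abs_le.1 (hx1 a)).2
      _ = _ := by
          rw [Finset.sum_const, Finset.card_univ, nsmul_eq_mul, ← hk]
          field_simp
  intro a
  have hpU := isPMF_seqType hn xU
  refine ⟨?_, (sum_sq_sub_le_of_divergence_le hpU hμ hD).1 a⟩
  refine (abs_sub_le_of_divergence_le hpU hμ (by positivity) hD a).trans (le_of_eq ?_)
  ring

/-- Every sequence has a companion whose conditional type is close to a given channel. -/
lemma exists_condType_close {X Y : Type*} [Fintype X] [Fintype Y] {W : X → Y → ℝ}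
    (hW : IsChannel W) {n : ℕ} (x : Fin n → X) :
    ∃ y : Fin n → Y, ∀ a b,
      |seqType (fun i => (x i, y i)) (a, b) - seqType x a * W a b| ≤ Fintype.card Y / n := by
  classical
  choose z hz using fun a => exists_rounding {i // x i = a} (hW a)
  refine ⟨fun i => z (x i) ⟨i, rfl⟩, fun a b => ?_⟩
  have h := (hz a b).1
  have hc : ((Finset.univ.filter fun i => (x i, z (x i) ⟨i, rfl⟩) = (a, b)).card : ℝ) =
      ((Finset.univ.filter fun j => z a j = b).card : ℝ) := by
    norm_cast
    symm
    refine Finset.card_bij (fun j _ => j.1) ?_ ?_ ?_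
    · rintro ⟨i, rfl⟩ hj
      simpa using hj
    · rintro j _ j' _ h
      exact Subtype.ext h
    · intro i hi
      simp only [Finset.mem_filter, Finset.mem_univ, true_and, Prod.mk.injEq] at hi
      obtain ⟨rfl, hi⟩ := hi
      exact ⟨⟨i, rfl⟩, by simpa using hi, rfl⟩
  have e : seqType (fun i => (x i, z (x i) ⟨i, rfl⟩)) (a, b) - seqType x a * W a b =
      (((Finset.univ.filter fun j => z a j = b).card : ℝ) -
        Fintype.card {i // x i = a} * W a b) / n := by
    rw [← hc, Fintype.card_subtype, sub_div, mul_div_right_comm, seqType, seqType]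
    congr!
  rw [e, abs_div, Nat.abs_cast]
  gcongr

end Rounding

/-! ### The exponent near the critical equivocation -/

section Critical

open Asymptotics

variable {X Y : Type*} [Fintype Y]

/-- The segment from the uniform channel to the channel `W`. -/
def mixChannel (W : X → Y → ℝ) (t : ℝ) (a : X) (b : Y) : ℝ :=
  (1 - t) * (1 / Fintype.card Y) + t * W a b

lemma mixChannel_pos [Nonempty Y] {W : X → Y → ℝ} (hW : IsChannel W) {t : ℝ} (h0 : 0 ≤ t)
    (h1 : t < 1) (a : X) (b : Y) : 0 < mixChannel W t a b := by
  have : (0 : ℝ) < Fintype.card Y := by exact_mod_cast Fintype.card_pos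
  exact add_pos_of_pos_of_nonneg (mul_pos (by linarith) (by positivity))
    (mul_nonneg h0 ((hW a).1 b))

lemma isChannel_mixChannel [Nonempty Y] {W : X → Y → ℝ} (hW : IsChannel W) {t : ℝ} (h0 : 0 ≤ t)
    (h1 : t ≤ 1) : IsChannel (mixChannel W t) := by
  have : (0 : ℝ) < Fintype.card Y := by exact_mod_cast Fintype.card_pos
  refine fun a => ⟨fun b => add_nonneg (mul_nonneg (by linarith) (by positivity))
    (mul_nonneg h0 ((hW a).1 b)), ?_⟩
  simp only [mixChannel, Finset.sum_add_distrib, ← Finset.mul_sum, (hW a).2, Finset.sum_const,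
    Finset.card_univ, nsmul_eq_mul]
  field_simp
  ring

variable [Fintype X]

lemma equivocation_uniform [Nonempty Y] {μX : X → ℝ} (hμ : IsPMF μX) :
    jointCondEntropy (fun (_ : Y) a => μX a * (1 / Fintype.card Y)) = entropy μX := by
  have hY : (0 : ℝ) < Fintype.card Y := by exact_mod_cast Fintype.card_pos
  set u : ℝ := 1 / (Fintype.card Y : ℝ) with hu
  have hu0 : 0 < u := by positivity
  have h1 : ∀ p, entropyTerm (p * u) = u * entropyTerm p + p * entropyTerm u := by
    intro p
    by_cases hp : p = 0
    · simp [hp, entropyTerm]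
    · unfold entropyTerm
      simp only [one_div, Real.logb_inv]
      rw [Real.logb_mul hp hu0.ne']
      ring
  simp only [jointCondEntropy, h1, ← Finset.sum_mul, hμ.2, Finset.sum_add_distrib,
    ← Finset.mul_sum, one_mul, Finset.sum_const, Finset.card_univ, nsmul_eq_mul]
  rw [entropy, hu]
  simp only [entropyTerm]
  field_simp
  simp

/-- On the way from the uniform channel to a channel of equivocation less than `R` there is a last
channel of equivocation at least `R`. -/
lemma exists_critical [Nonempty Y] {μX : X → ℝ} (hμ : IsPMF μX) {R : ℝ} (hR : R ≤ entropy μX)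
    {W : X → Y → ℝ} (hW : IsChannel W) (hWR : equivocation μX W < R) :
    ∃ t₀ : ℝ, 0 ≤ t₀ ∧ t₀ < 1 ∧
      R ≤ jointCondEntropy (fun b a => μX a * mixChannel W t₀ a b) ∧
      ∀ t, t₀ < t → t ≤ 1 → equivocation μX (mixChannel W t) < R := by
  set f : ℝ → ℝ := fun t => jointCondEntropy (fun b a => μX a * mixChannel W t a b) with hf
  have hfc : Continuous f := by
    refine continuous_jointCondEntropy.comp ?_
    unfold mixChannel
    fun_prop
  have hf0 : R ≤ f 0 := by
    simp only [hf, mixChannel, sub_zero, one_mul, zero_mul, add_zero]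
    rwa [equivocation_uniform hμ]
  have hf1 : f 1 < R := by
    simp only [hf, mixChannel, sub_self, one_mul, zero_mul, zero_add]
    rwa [equivocation_eq hμ hW] at hWR
  have hK : IsCompact (Set.Icc (0 : ℝ) 1 ∩ {t | R ≤ f t}) :=
    isCompact_Icc.inter_right (isClosed_le continuous_const hfc)
  obtain ⟨t₀, ⟨⟨h0, h1⟩, h2⟩, hmax⟩ := hK.exists_isGreatest ⟨0, ⟨le_rfl, zero_le_one⟩, hf0⟩
  refine ⟨t₀, h0, lt_of_le_of_ne h1 fun h => ?_, h2, fun t ht ht1 => ?_⟩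
  · subst h
    exact absurd hf1 (not_lt.2 h2)
  · rw [equivocation_eq hμ (isChannel_mixChannel hW (h0.trans ht.le) ht1)]
    by_contra hc
    exact absurd (hmax ⟨⟨h0.trans ht.le, ht1⟩, not_lt.1 hc⟩) (not_le.2 ht)

lemma tendsto_of_isBigO_inv {q : ℕ → ℝ} {p : ℝ}
    (hq : (fun n => q n - p) =O[atTop] fun n : ℕ => (n : ℝ)⁻¹) : Tendsto q atTop (𝓝 p) := by
  have := hq.trans_tendsto tendsto_inv_atTop_nhds_zero_nat
  simpa using this.add_const p

lemma isBigO_comp_of_differentiableAt {φ : ℝ → ℝ} {q : ℕ → ℝ} {p : ℝ}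
    (hφ : DifferentiableAt ℝ φ p)
    (hq : (fun n => q n - p) =O[atTop] fun n : ℕ => (n : ℝ)⁻¹) :
    (fun n => φ (q n) - φ p) =O[atTop] fun n : ℕ => (n : ℝ)⁻¹ :=
  (hφ.isBigO_sub.comp_tendsto (tendsto_of_isBigO_inv hq)).trans hq

lemma isBigO_inv_of_abs_le {q : ℕ → ℝ} {p C : ℝ} (h : ∀ᶠ n : ℕ in atTop, |q n - p| ≤ C / n) :
    (fun n => q n - p) =O[atTop] fun n : ℕ => (n : ℝ)⁻¹ := by
  refine IsBigO.of_bound C ?_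
  filter_upwards [h] with n hn
  rw [Real.norm_eq_abs, norm_inv, RCLike.norm_natCast]
  exact hn

lemma isBigO_fintype_sum {ι : Type*} [Fintype ι] {f : ι → ℕ → ℝ} {g : ℕ → ℝ}
    (h : ∀ i, f i =O[atTop] g) : (fun n => ∑ i, f i n) =O[atTop] g := by
  have := IsBigO.sum (s := Finset.univ) fun i _ => h i
  exact this.congr_left fun n => Finset.sum_apply _ _ _

lemma differentiableAt_entropyTerm {p : ℝ} (hp : p ≠ 0) : DifferentiableAt ℝ entropyTerm p := by
  rw [funext entropyTerm_eq]
  exact (Real.differentiableAt_negMulLog hp).div_const _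

lemma differentiableAt_logb {p : ℝ} (hp : p ≠ 0) : DifferentiableAt ℝ (Real.logb 2) p := by
  have : Real.logb 2 = fun x => Real.log x / Real.log 2 := rfl
  rw [this]
  exact (Real.differentiableAt_log hp).div_const _

/-- Joint distributions that tend to a distribution at rate `1/n`, without leaving its support,
have conditional entropies that tend at the same rate. -/
lemma isBigO_jointCondEntropy {P : ℕ → Y → X → ℝ} {Q : Y → X → ℝ} (hQ : ∀ b a, 0 ≤ Q b a)
    (hP : ∀ b a, (fun n => P n b a - Q b a) =O[atTop] fun n : ℕ => (n : ℝ)⁻¹)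
    (h0 : ∀ b a, Q b a = 0 → ∀ᶠ n in atTop, P n b a = 0) :
    (fun n => jointCondEntropy (P n) - jointCondEntropy Q) =O[atTop] fun n : ℕ => (n : ℝ)⁻¹ := by
  have hzero : ∀ {q : ℕ → ℝ} {p : ℝ}, (p = 0 → ∀ᶠ n in atTop, q n = 0) →
      ((fun n => q n - p) =O[atTop] fun n : ℕ => (n : ℝ)⁻¹) →
      (fun n => entropyTerm (q n) - entropyTerm p) =O[atTop] fun n : ℕ => (n : ℝ)⁻¹ := by
    intro q p hq0 hq
    by_cases hp : p = 0
    · refine IsBigO.congr' (isBigO_zero _ _) ?_ EventuallyEq.rfl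
      filter_upwards [hq0 hp] with n hn
      rw [hn, hp, sub_self]
    · exact isBigO_comp_of_differentiableAt (differentiableAt_entropyTerm hp) hq
  have hterm : ∀ b, (fun n => (∑ a, entropyTerm (P n b a) - entropyTerm (∑ a, P n b a)) -
      (∑ a, entropyTerm (Q b a) - entropyTerm (∑ a, Q b a))) =O[atTop]
        fun n : ℕ => (n : ℝ)⁻¹ := by
    intro b
    have h1 : (fun n => ∑ a, (entropyTerm (P n b a) - entropyTerm (Q b a))) =O[atTop]
        fun n : ℕ => (n : ℝ)⁻¹ := isBigO_fintype_sum fun a => hzero (h0 b a) (hP b a)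
    have h2 : (fun n => ∑ a, P n b a - ∑ a, Q b a) =O[atTop] fun n : ℕ => (n : ℝ)⁻¹ := by
      simp only [← Finset.sum_sub_distrib]
      exact isBigO_fintype_sum fun a => hP b a
    have h3 := hzero (fun hs => by
      have hz := (Finset.sum_eq_zero_iff_of_nonneg fun a _ => hQ b a).1 hs
      have : ∀ᶠ n in atTop, ∀ a, P n b a = 0 :=
        eventually_all.2 fun a => h0 b a (hz a (Finset.mem_univ a))
      filter_upwards [this] with n hn
      exact Finset.sum_eq_zero fun a _ => hn a) h2
    refine (h1.sub h3).congr_left fun n => ?_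
    rw [Finset.sum_sub_distrib]
    ring
  have := isBigO_fintype_sum hterm
  refine this.congr_left fun n => ?_
  rw [Finset.sum_sub_distrib]
  rfl

lemma exponent_le {n : ℕ} {U : X → ℝ} {x : Fin n → X} (hx : seqType x = U) (y : Fin n → Y)
    (R : ℝ) (W : X → Y → ℝ) : exponent n U R W ≤ condDivergence (condType y x) W U +
      ((max (R - empCondEntropy x y) 0 : ℝ) : EReal) :=
  iInf_le_of_le x (iInf_le_of_le y (iInf_le_of_le hx le_rfl))

/-- The channels of equivocation less than `R` come so close to equivocation `R` that the infimum
of their exponents is `O(1/n)`, so that it does not exceed the polynomial loss. -/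
lemma eventually_infExponent_zero_le [Nonempty Y] {μX : X → ℝ} (hμ : IsPMF μX) {R : ℝ}
    (hR : R ≤ entropy μX) (hne : (channelClass Y μX R).Nonempty) {U : ℕ → X → ℝ}
    (hU : ∀ n, IsNearestType μX n (U n)) :
    ∀ᶠ n : ℕ in atTop, infExponent Y μX n (U n) R 0 ≤ ((2 * lam X Y n : ℝ) : EReal) := by
  obtain ⟨W, hW, hWR⟩ := hne
  obtain ⟨t₀, ht0, ht1, hcrit, hlt⟩ := exists_critical hμ hR hW hWR
  obtain ⟨C, hC⟩ := exists_nearestType_close hμ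
  choose x hx using fun n => (hU n).1
  have hW₀ := isChannel_mixChannel hW ht0 ht1.le
  choose y hy using fun n => exists_condType_close hW₀ (x n)
  -- the channel and the joint type at length `n`
  let s : ℕ → ℝ := fun n => t₀ + (1 - t₀) / n
  let V : ℕ → X → Y → ℝ := fun n => mixChannel W (s n)
  let P : ℕ → Y → X → ℝ := fun n b a => seqType (fun i => (x n i, y n i)) (a, b)
  have hs1 : ∀ n, 2 ≤ n → t₀ < s n ∧ s n < 1 := by
    intro n hn
    have hn' : (2 : ℝ) ≤ n := by exact_mod_cast hn
    have h1 : 0 < 1 - t₀ := by linarith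
    refine ⟨by simp only [s]; linarith [div_pos h1 (by linarith : (0 : ℝ) < n)], ?_⟩
    have : (1 - t₀) / n < 1 - t₀ := div_lt_self h1 (by linarith)
    simp only [s]
    linarith
  have hWpos := mixChannel_pos hW ht0 ht1
  have hUO : ∀ a, (fun n => U n a - μX a) =O[atTop] fun n : ℕ => (n : ℝ)⁻¹ := fun a =>
    isBigO_inv_of_abs_le (C := C) (by
      filter_upwards [eventually_ne_atTop 0] with n hn
      exact (hC n hn (U n) (hU n) a).1)
  have hVO : ∀ a b, (fun n => V n a b - mixChannel W t₀ a b) =O[atTop]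
      fun n : ℕ => (n : ℝ)⁻¹ := by
    intro a b
    have : (fun n => V n a b - mixChannel W t₀ a b) = fun n : ℕ =>
        ((1 - t₀) * (W a b - 1 / Fintype.card Y)) * (n : ℝ)⁻¹ := by
      funext n
      simp only [V, s, mixChannel]
      ring
    rw [this]
    exact isBigO_const_mul_self _ _ _
  have hPO : ∀ b a, (fun n => P n b a - μX a * mixChannel W t₀ a b) =O[atTop]
      fun n : ℕ => (n : ℝ)⁻¹ := by
    intro b a
    have h1 : (fun n => (P n b a - U n a * mixChannel W t₀ a b) - 0) =O[atTop]
        fun n : ℕ => (n : ℝ)⁻¹ := isBigO_inv_of_abs_le (C := Fintype.card Y) (by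
      filter_upwards with n
      rw [sub_zero, ← hx n]
      exact hy n a b)
    have h2 := (hUO a).const_mul_left (mixChannel W t₀ a b)
    refine (h1.add h2).congr_left fun n => ?_
    ring
  have hP0 : ∀ b a, μX a = 0 → ∀ᶠ n in atTop, P n b a = 0 := by
    intro b a ha
    filter_upwards [eventually_ne_atTop 0] with n hn
    have h1 := (hC n hn (U n) (hU n) a).2 ha
    rw [← hx n] at h1
    simp only [P]
    rw [← seqType_swap, ← condType_mul_seqType (y n) (x n), h1, mul_zero]
  have hHO : (fun n => empCondEntropy (x n) (y n) -
      jointCondEntropy (fun b a => μX a * mixChannel W t₀ a b)) =O[atTop]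
        fun n : ℕ => (n : ℝ)⁻¹ := by
    simp only [empCondEntropy_eq]
    refine isBigO_jointCondEntropy (fun b a => mul_nonneg (hμ.1 a) (hWpos a b).le) hPO ?_
    exact fun b a h => hP0 b a ((mul_eq_zero.1 h).resolve_right (hWpos a b).ne')
  let D : ℕ → ℝ := fun n => ∑ a, seqType (x n) a *
    ∑ b, condType (y n) (x n) a b * Real.logb 2 (condType (y n) (x n) a b / V n a b)
  have hDO : D =O[atTop] fun n : ℕ => (n : ℝ)⁻¹ := by
    have hterm : ∀ a b, (fun n => P n b a *
        Real.logb 2 (condType (y n) (x n) a b / V n a b)) =O[atTop] fun n : ℕ => (n : ℝ)⁻¹ := by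
      intro a b
      by_cases ha : μX a = 0
      · refine IsBigO.congr' (isBigO_zero _ _) ?_ EventuallyEq.rfl
        filter_upwards [hP0 b a ha] with n hn
        rw [hn, zero_mul]
      · have ha0 : 0 < μX a := lt_of_le_of_ne (hμ.1 a) (Ne.symm ha)
        have hQ0 : 0 < μX a * mixChannel W t₀ a b := mul_pos ha0 (hWpos a b)
        have h1 := isBigO_comp_of_differentiableAt (differentiableAt_logb hQ0.ne') (hPO b a)
        have h2 := isBigO_comp_of_differentiableAt (differentiableAt_logb ha) (hUO a)
        have h3 := isBigO_comp_of_differentiableAt (differentiableAt_logb (hWpos a b).ne')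
          (hVO a b)
        have hPt := tendsto_of_isBigO_inv (hPO b a)
        have h4 := (hPt.isBigO_one ℝ).mul ((h1.sub h2).sub h3)
        simp only [one_mul] at h4
        refine h4.congr' ?_ EventuallyEq.rfl
        filter_upwards [hPt.eventually_const_lt hQ0,
          (tendsto_of_isBigO_inv (hUO a)).eventually_const_lt ha0,
          (tendsto_of_isBigO_inv (hVO a b)).eventually_const_lt (hWpos a b)] with n hp hu hv
        have e : condType (y n) (x n) a b = P n b a / U n a := by
          rw [condType, seqType_swap, hx n]
        rw [e, Real.logb_div (div_pos hp hu).ne' hv.ne', Real.logb_div hp.ne' hu.ne',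
          Real.logb_mul ha (hWpos a b).ne']
        ring
    have h5 := isBigO_fintype_sum fun a => isBigO_fintype_sum fun b => hterm a b
    refine h5.congr_left fun n => ?_
    refine Finset.sum_congr rfl fun a _ => ?_
    rw [Finset.mul_sum]
    refine Finset.sum_congr rfl fun b _ => ?_
    simp only [P]
    rw [← seqType_swap, ← condType_mul_seqType (y n) (x n)]
    ring
  obtain ⟨K, hK⟩ := (hDO.norm_left.add hHO.norm_left).bound
  have hX : Nonempty X := by
    by_contra h
    rw [not_nonempty_iff] at h
    have := hμ.2
    simp at this
  have hcard : (1 : ℝ) ≤ Fintype.card X * Fintype.card Y := by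
    have := Fintype.card_pos (α := X)
    have := Fintype.card_pos (α := Y)
    exact_mod_cast Nat.mul_pos ‹0 < Fintype.card X› ‹0 < Fintype.card Y›
  have hlog : Tendsto (fun n : ℕ => Real.logb 2 ((n : ℝ) + 1)) atTop atTop :=
    (Real.tendsto_logb_atTop (by norm_num)).comp
      (tendsto_natCast_atTop_atTop.atTop_add tendsto_const_nhds)
  filter_upwards [hK, hlog.eventually_ge_atTop K, hlog.eventually_ge_atTop 0,
    eventually_ge_atTop 2] with n hn hlogn hlog0 hn2
  obtain ⟨hs0, hs1⟩ := hs1 n hn2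
  have hn' : (0 : ℝ) < n := by positivity
  have hVpos := mixChannel_pos hW (ht0.trans hs0.le) hs1
  have hmem : V n ∈ channelClass Y μX (R - 0) := by
    rw [sub_zero]
    exact ⟨isChannel_mixChannel hW (ht0.trans hs0.le) hs1.le, hlt _ hs0 hs1.le⟩
  refine (iInf₂_le (V n) hmem).trans ?_
  refine (exponent_le (hx n) (y n) R (V n)).trans ?_
  rw [← hx n, condDivergence, if_pos fun b a _ h => absurd h (hVpos b a).ne', ← EReal.coe_add,
    EReal.coe_le_coe_iff]
  change D n + max (R - empCondEntropy (x n) (y n)) 0 ≤ 2 * lam X Y n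
  have h6 : D n + max (R - empCondEntropy (x n) (y n)) 0 ≤ K / n := by
    have h7 : ‖‖D n‖ + ‖empCondEntropy (x n) (y n) -
      jointCondEntropy (fun b a => μX a * mixChannel W t₀ a b)‖‖ ≤ K * ‖(n : ℝ)⁻¹‖ := hn
    rw [Real.norm_of_nonneg (add_nonneg (norm_nonneg _) (norm_nonneg _)),
      Real.norm_of_nonneg (inv_nonneg.2 hn'.le),
      ← div_eq_mul_inv] at h7
    refine le_trans (add_le_add (le_abs_self _) (max_le ?_ (norm_nonneg _))) h7
    rw [Real.norm_eq_abs, abs_sub_comm]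
    exact le_trans (by linarith) (le_abs_self _)
  refine h6.trans ?_
  rw [lam, ← mul_div_assoc]
  gcongr
  nlinarith

end Critical

/-! ### The error bound -/

section Bound

variable {X : Type*} (Y : Type*) [Fintype X] [Fintype Y]

/-- The bound for single joint types applies to the nearest types, since these are at least as
close to `μX` as the many sequences counted in `eventually_le_card_divergence_le`. -/
lemma exists_infExponent_lower_bound {μX : X → ℝ} (hμ : IsPMF μX) (R : ℝ) {δ : ℝ} (hδ : 0 < δ)
    {U : ℕ → X → ℝ} (hU : ∀ n, IsNearestType μX n (U n)) :
    ∃ ε : ℝ, 0 < ε ∧ ∀ᶠ n : ℕ in atTop, (ε : EReal) ≤ infExponent Y μX n (U n) R δ := by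
  classical
  obtain ⟨ε, hε, γ, hγ, h⟩ := exists_exponent_lower_bound (Y := Y) hμ R hδ
  refine ⟨ε, hε, ?_⟩
  filter_upwards [eventually_le_card_divergence_le hμ hγ one_pos, eventually_ne_atTop 0]
    with n hn hn0
  -- some sequence is within `γ` of `μX`, so the nearest type is
  obtain ⟨x₀, hx₀⟩ : (Finset.univ.filter fun x : Fin n → X =>
      divergence (seqType x) μX ≤ (γ : EReal)).Nonempty := by
    rw [← Finset.card_pos]
    have : (0 : ℝ) < (2 : ℝ) ^ ((n : ℝ) * (entropy μX - 1)) := by positivity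
    exact_mod_cast this.trans_le hn
  have hUγ : divergence (U n) μX ≤ (γ : EReal) :=
    ((hU n).2 x₀).trans (Finset.mem_filter.1 hx₀).2
  refine le_iInf₂ fun W hW => ?_
  unfold exponent
  refine le_iInf fun x => le_iInf fun y => le_iInf fun hx => ?_
  rw [← hx] at hUγ ⊢
  exact h n hn0 x y W hW.1 hUγ hW.2

variable {Y}

lemma exponent_ne_top {n : ℕ} {U : X → ℝ} (hU : ∃ x : Fin n → X, seqType x = U) (R : ℝ)
    {W : X → Y → ℝ} (hW : IsChannel W) : exponent n U R W ≠ ⊤ := by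
  obtain ⟨x, hx⟩ := hU
  have hex : ∀ a, ∃ b, W a b ≠ 0 := by
    intro a
    by_contra! h
    have := (hW a).2
    simp [h] at this
  choose z hz using hex
  refine ne_top_of_le_ne_top ?_ (exponent_le hx (fun i => z (x i)) R W)
  rw [condDivergence, if_pos]
  · rw [← EReal.coe_add]
    exact EReal.coe_ne_top _
  · intro a b _ hab
    by_contra hne
    have hpair : seqType (fun i => (z (x i), x i)) (b, a) ≠ 0 := fun h =>
      hne (by simp [condType, h])
    obtain ⟨i, hi⟩ := exists_of_seqType_ne_zero hpair
    simp only [Prod.mk.injEq] at hi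
    exact hz a (by rw [← hi.2] at hab ⊢; rwa [← hi.1] at hab)

lemma infExponent_ne_top {μX : X → ℝ} {n : ℕ} {U : X → ℝ} (hU : ∃ x : Fin n → X, seqType x = U)
    {R δ : ℝ} (hne : (channelClass Y μX (R - δ)).Nonempty) :
    infExponent Y μX n U R δ ≠ ⊤ := by
  obtain ⟨W, hW⟩ := hne
  exact ne_top_of_le_ne_top (exponent_ne_top hU R hW.1) (iInf₂_le W hW)

lemma two_rpow_mul_lam {n : ℕ} (hn : n ≠ 0) :
    (2 : ℝ) ^ ((n : ℝ) * (2 * lam X Y n)) =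
      ((n : ℝ) + 1) ^ (2 * (Fintype.card X * Fintype.card Y)) := by
  have hn' : (n : ℝ) ≠ 0 := by exact_mod_cast hn
  have e : (n : ℝ) * (2 * lam X Y n) = Real.logb 2 ((n : ℝ) + 1) *
      ((2 * (Fintype.card X * Fintype.card Y) : ℕ) : ℝ) := by
    rw [lam]
    push_cast
    field_simp
  rw [e, Real.rpow_mul (by norm_num), Real.rpow_logb (by norm_num) (by norm_num) (by positivity),
    Real.rpow_natCast]

variable {αA βA αAB βAB κ : ℕ → ℝ}

/-- The error bound vanishes if the exponents stay away from zero. -/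
lemma tendsto_errorBound (hαA : Tendsto αA atTop (𝓝 1)) (hαAB : Tendsto αAB atTop (𝓝 1))
    (hβAB : Tendsto βAB atTop (𝓝 0)) (hκ : Tendsto κ atTop atTop)
    (hκβ : Tendsto (fun n => κ n * βA n) atTop (𝓝 0))
    (hκlog : Tendsto (fun n : ℕ => Real.logb 2 (κ n) / n) atTop (𝓝 0))
    {F : ℕ → ℝ} {ε : ℝ} (hε : 0 < ε) (hF : ∀ᶠ n in atTop, ε ≤ F n) :
    Tendsto (fun n => errorBound X Y n (αA n) (βA n) (αAB n) (βAB n) (κ n) (F n))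
      atTop (𝓝 0) := by
  have hexp : Tendsto (fun n : ℕ => κ n * (max (αA n) 1 *
      (2 : ℝ) ^ (-(n : ℝ) * (F n - 2 * lam X Y n)))) atTop (𝓝 0) := by
    have hs := ((subexponential_of_logb (hκ.eventually_gt_atTop 0) hκlog).mul
      (subexponential_of_tendsto (hαA.max (tendsto_const_nhds (x := (1 : ℝ)))))).mul
        (subexponential_poly (2 * (Fintype.card X * Fintype.card Y)))
    refine tendsto_of_tendsto_of_tendsto_of_le_of_le' tendsto_const_nhds (hs ε hε) ?_ ?_
    · filter_upwards [hκ.eventually_ge_atTop 0] with n hn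
      positivity
    · filter_upwards [hκ.eventually_ge_atTop 0, hF, eventually_ne_atTop 0] with n hn hFn hn0
      have e : -(n : ℝ) * (F n - 2 * lam X Y n) = n * (2 * lam X Y n) + -(n : ℝ) * F n := by ring
      rw [e, Real.rpow_add (by norm_num), two_rpow_mul_lam hn0]
      calc _ = κ n * max (αA n) 1 * ((n : ℝ) + 1) ^ (2 * (Fintype.card X * Fintype.card Y)) *
            (2 : ℝ) ^ (-(n : ℝ) * F n) := by ring
        _ ≤ _ := by
            refine mul_le_mul_of_nonneg_left ?_ (by positivity)
            apply Real.rpow_le_rpow_of_exponent_le (by norm_num)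
            have : (n : ℝ) * ε ≤ n * F n := by gcongr
            linarith
  have h1 : Tendsto (fun n => αAB n - 1) atTop (𝓝 (1 - 1)) := hαAB.sub_const 1
  have h2 : Tendsto (fun n => (βAB n + 1) / κ n) atTop (𝓝 0) := (hβAB.add_const 1).div_atTop hκ
  have h3 := ((h1.add h2).add ((hexp.add hκβ).const_mul 2))
  simp only [sub_self, add_zero, mul_zero] at h3
  refine h3.congr fun n => ?_
  rw [errorBound]
  ring

/-- The error bound is trivial if the exponent does not exceed the polynomial loss. -/
lemma eventually_one_le_errorBound (hαAB : Tendsto αAB atTop (𝓝 1))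
    (hβAB : Tendsto βAB atTop (𝓝 0)) (hκ : Tendsto κ atTop atTop)
    (hκβ : Tendsto (fun n => κ n * βA n) atTop (𝓝 0))
    {F : ℕ → ℝ} (hF : ∀ᶠ n in atTop, F n ≤ 2 * lam X Y n) :
    ∀ᶠ n in atTop, 1 ≤ errorBound X Y n (αA n) (βA n) (αAB n) (βAB n) (κ n) (F n) := by
  filter_upwards [hF, hκ.eventually_ge_atTop 2, hαAB.eventually_const_lt (show (0 : ℝ) < 1 by
    norm_num), hβAB.eventually_const_lt (show (-1 : ℝ) < 0 by norm_num),
    hκβ.eventually_const_lt (show (-1 / 2 : ℝ) < 0 by norm_num)] with n h1 h2 h3 h4 h5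
  have h6 : 0 ≤ (βAB n + 1) / κ n := div_nonneg (by linarith) (by linarith)
  have h7 : (1 : ℝ) ≤ 2 ^ (-(n : ℝ) * (F n - 2 * lam X Y n)) := by
    apply Real.one_le_rpow (by norm_num)
    exact mul_nonneg_of_nonpos_of_nonpos (by simp) (by linarith)
  have h8 : 1 * 1 ≤ max (αA n) 1 * (2 : ℝ) ^ (-(n : ℝ) * (F n - 2 * lam X Y n)) := by
    gcongr
    exact le_max_right _ _
  have h9 : κ n * 1 ≤ κ n * (max (αA n) 1 * (2 : ℝ) ^ (-(n : ℝ) * (F n - 2 * lam X Y n))) := by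
    gcongr
    linarith
  rw [errorBound]
  nlinarith

end Bound

end UnivChannel

end

theorem theorem2
    {X : Type*} {Y : Type*} [Fintype X] [Fintype Y]
    {CA : ℕ → Type*} {CB : ℕ → Type*} [∀ n, Fintype (CA n)] [∀ n, Fintype (CB n)]
    -- the ensembles and their hash properties
    (EA : ∀ n, UnivChannel.Ensemble (Fin n → X) (CA n))
    (EB : ∀ n, UnivChannel.Ensemble (Fin n → X) (CB n))
    (αA βA αAB βAB : ℕ → ℝ)
    (hA : UnivChannel.HashProperty EA αA βA)
    (hAB : UnivChannel.HashProperty (fun n => (EA n).prod (EB n)) αAB βAB)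
    (him : ∀ n, 1 ≤ n → ((EA n).prod (EB n)).im = (EA n).im ×ˢ (EB n).im)
    -- the rates and the input distribution
    (RA RB : ℝ) (hRA : 0 < RA) (hRB : 0 < RB)
    (hrateA : Tendsto (fun n : ℕ => Real.logb 2 ((EA n).im.ncard : ℝ) / n) atTop (𝓝 RA))
    (hrateB : Tendsto (fun n : ℕ => Real.logb 2 ((EB n).im.ncard : ℝ) / n) atTop (𝓝 RB))
    (μX : X → ℝ) (hμX : UnivChannel.IsPMF μX)
    (hH : RA + RB < UnivChannel.entropy μX)
    -- the sequence `κ`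
    (κ : ℕ → ℝ) (hκ : Tendsto κ atTop atTop)
    (hκβ : Tendsto (fun n => κ n * βA n) atTop (𝓝 0))
    (hκlog : Tendsto (fun n : ℕ => Real.logb 2 (κ n) / n) atTop (𝓝 0))
    -- a fixed enumeration of `X^n`, which resolves the ties of the encoder
    (r : ∀ n, (Fin n → X) → ℕ) (hr : ∀ n, Function.Injective (r n))
    -- the type of length `n` closest to `μX`
    (U : ℕ → X → ℝ) (hU : ∀ n, UnivChannel.IsNearestType μX n (U n)) :
    (∃ (A : ∀ n, (Fin n → X) → CA n) (B : ∀ n, (Fin n → X) → CB n) (c : ∀ n, CA n),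
      (∀ n, A n ∈ (EA n).fns ∧ B n ∈ (EB n).fns ∧ c n ∈ Set.range (A n)) ∧
      -- the error bound, for all channels of the class at once
      (∀ δ : ℝ, 0 ≤ δ → ∀ᶠ n : ℕ in atTop,
        ∀ g : (Fin n → Y) → (Fin n → X), UnivChannel.IsMinEntropyDecoder (A n) (c n) g →
        ∀ W ∈ UnivChannel.channelClass Y μX (RA - δ),
          UnivChannel.codeError W (B n)
              (UnivChannel.minDivEncoder μX (r n) (A n) (B n) (c n)) g ≤
            UnivChannel.errorBound X Y n (αA n) (βA n) (αAB n) (βAB n) (κ n)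
              (UnivChannel.infExponent Y μX n (U n) RA δ).toReal) ∧
      -- the error probability vanishes for every channel with `H(X|Y) < RA`
      (∀ g : ∀ n, (Fin n → Y) → (Fin n → X),
        (∀ n, UnivChannel.IsMinEntropyDecoder (A n) (c n) (g n)) →
        ∀ W ∈ UnivChannel.channelClass Y μX RA,
          Tendsto (fun n => UnivChannel.codeError W (B n)
              (UnivChannel.minDivEncoder μX (r n) (A n) (B n) (c n)) (g n))
            atTop (𝓝 0))) ∧
    -- the infimum of the exponent is bounded away from zero, and the bound vanishes
    (∀ δ : ℝ, 0 < δ →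
      (∃ ε : ℝ, 0 < ε ∧ ∀ᶠ n : ℕ in atTop,
        (ε : EReal) ≤ UnivChannel.infExponent Y μX n (U n) RA δ) ∧
      ((UnivChannel.channelClass Y μX (RA - δ)).Nonempty →
        Tendsto (fun n => UnivChannel.errorBound X Y n (αA n) (βA n) (αAB n) (βAB n) (κ n)
            (UnivChannel.infExponent Y μX n (U n) RA δ).toReal)
          atTop (𝓝 0))) := by 
  classical
  have hX : Nonempty X := by
    by_contra h
    rw [not_nonempty_iff] at h
    have := hμX.2
    simp at this
  obtain ⟨A, B, c, hmem, hbound⟩ := UnivChannel.exists_universal_codes Y EA EB hA hAB him hRA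
    hrateA hrateB hμX hH hκ hκlog r hr
  have hlow := fun δ (hδ : 0 < δ) =>
    UnivChannel.exists_infExponent_lower_bound Y hμX RA (δ := δ) hδ hU
  have htend : ∀ δ : ℝ, 0 < δ → (UnivChannel.channelClass Y μX (RA - δ)).Nonempty →
      Tendsto (fun n => UnivChannel.errorBound X Y n (αA n) (βA n) (αAB n) (βAB n) (κ n)
        (UnivChannel.infExponent Y μX n (U n) RA δ).toReal) atTop (𝓝 0) := by
    intro δ hδ hne
    obtain ⟨ε, hε, hF⟩ := hlow δ hδ
    refine UnivChannel.tendsto_errorBound hA.alpha_lim hAB.alpha_lim hAB.beta_lim hκ hκβ hκlog hε ?_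
    filter_upwards [hF] with n hn
    have h1 := EReal.toReal_le_toReal hn (EReal.coe_ne_bot ε)
      (UnivChannel.infExponent_ne_top (hU n).1 hne)
    rwa [EReal.toReal_coe] at h1
  have hpos : ∀ δ : ℝ, 0 < δ → ∀ᶠ n : ℕ in atTop,
      ∀ g : (Fin n → Y) → (Fin n → X), UnivChannel.IsMinEntropyDecoder (A n) (c n) g →
      ∀ W ∈ UnivChannel.channelClass Y μX (RA - δ),
        UnivChannel.codeError W (B n)
            (UnivChannel.minDivEncoder μX (r n) (A n) (B n) (c n)) g ≤
          UnivChannel.errorBound X Y n (αA n) (βA n) (αAB n) (βAB n) (κ n)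
            (UnivChannel.infExponent Y μX n (U n) RA δ).toReal := by
    intro δ hδ
    filter_upwards [hbound δ hδ, hκ.eventually_ge_atTop 0] with n hn hκn g hg W hW
    refine (hn g hg W hW).trans ?_
    have h1 : 0 ≤ 2 * κ n * (max (αA n) 1 * (2 : ℝ) ^ (-(n : ℝ) *
        ((UnivChannel.infExponent Y μX n (U n) RA δ).toReal - 2 * UnivChannel.lam X Y n))) := by
      positivity
    rw [UnivChannel.errorBound]
    linarith
  refine ⟨⟨A, B, c, hmem, fun δ hδ => ?_, fun g hg W hW => ?_⟩,
    fun δ hδ => ⟨hlow δ hδ, htend δ hδ⟩⟩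
  · rcases hδ.eq_or_lt with rfl | hδ
    swap
    · exact hpos δ hδ
    rw [sub_zero]
    by_cases hne : (UnivChannel.channelClass Y μX RA).Nonempty
    swap
    · exact Eventually.of_forall fun n g _ W hW => absurd ⟨W, hW⟩ hne
    have hY : Nonempty Y := by
      obtain ⟨W, hW⟩ := hne
      by_contra h
      rw [not_nonempty_iff] at h
      have := (hW.1 (Classical.arbitrary X)).2
      simp at this
    have hF : ∀ᶠ n : ℕ in atTop, (UnivChannel.infExponent Y μX n (U n) RA 0).toReal ≤
        2 * UnivChannel.lam X Y n := by
      filter_upwards [UnivChannel.eventually_infExponent_zero_le hμX (by linarith) hne hU]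
        with n hn
      have hlam : 0 ≤ 2 * UnivChannel.lam X Y n := by
        unfold UnivChannel.lam
        have : 0 ≤ Real.logb 2 ((n : ℝ) + 1) := Real.logb_nonneg (by norm_num) (by simp)
        positivity
      -- `toReal ⊥ = 0` also satisfies the bound
      by_cases hbot : UnivChannel.infExponent Y μX n (U n) RA 0 = ⊥
      · rwa [hbot, EReal.toReal_bot]
      · have h1 := EReal.toReal_le_toReal hn hbot (EReal.coe_ne_top _)
        rwa [EReal.toReal_coe] at h1
    filter_upwards [UnivChannel.eventually_one_le_errorBound hAB.alpha_lim hAB.beta_lim hκ hκβ hF]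
      with n hn g _ W hW
    exact (UnivChannel.codeError_le_one hW.1 _ _ _).trans hn
  · obtain ⟨δ, hδ, hWδ⟩ : ∃ δ : ℝ, 0 < δ ∧ W ∈ UnivChannel.channelClass Y μX (RA - δ) := by
      refine ⟨(RA - UnivChannel.equivocation μX W) / 2, ?_, hW.1, ?_⟩
      · have := hW.2
        linarith
      · have := hW.2
        linarith
    refine tendsto_of_tendsto_of_tendsto_of_le_of_le' tendsto_const_nhds
      (htend δ hδ ⟨W, hWδ⟩) (Eventually.of_forall fun n =>
        UnivChannel.codeError_nonneg hW.1 _ _ _) ?_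
    filter_upwards [hpos δ hδ] with n hn
    exact hn (g n) (hg n) W hWδ
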